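/- Throughout, $\log=\log_2$, graphs are finite and simple, $n$ is a positive integer, and $G_{n,p}$ is the Erdős–Rényi random graph on the vertex set $\{1,\dots,n\}$ in which each edge of $K_n$ is present independently with probability $p$. A copy of a graph $J$ in a graph $G$ is a (not necessarily induced, unlabeled) subgraph of $G$ isomorphic to $J$; $N(G,J)$ is the number of such copies, and $\mathbb{E}_pX_J=\mathbb{E}\,N(G_{n,p},J)$. For a graph $H$ with at most $n$ vertices, the graphic expectation threshold and the fractional expectation threshold of $H$ are $$p_E(H)=p_E(n,H)=\min\{p\in[0,1]:\ \mathbb{E}_pX_I\ge 1/2\ \text{ for all } I\subseteq H\},$$ $$p_E^*(H)=p_E^*(n,H)=\min\{p\in[0,1]:\ \mathbb{E}_pX_I\ge N(H,I)/2\ \text{ for all } I\subseteq H\}.$$ **Theorem.** There is a universal constant $K$ such that for every $n$ and every graph $H$ with at least one edge and at most $n$ vertices, $$p_E^*(H)<K\,p_E(H)\log^2 n.$$ Furthermore, there is a universal constant $\alpha>0$ such that for every $n$ and every graph $H$ with at least one edge and at most $n$ vertices, if $p_E(H)<1/(3n)$, then $p_E^*(H)<\alpha^{-1}p_E(H)$.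 -/

import Mathlib

open MeasureTheory unitInterval
open scoped SimpleGraph

universe u

/-- `expCopies n p J` is the expected number of (unlabeled, not necessarily induced) copies of the
graph `J` in the binomial random graph `G(n, p)` on the vertex set `Fin n`. -/
noncomputable def expCopies {W : Type*} (n : ℕ) (p : I) (J : SimpleGraph W) : ℝ :=
  ∫ G : SimpleGraph (Fin n), (G.copyCount J : ℝ) ∂(SimpleGraph.binomialRandom (Fin n) p)

/-- The probabilities `p ∈ [0, 1]` at which every subgraph of `H` has at least `1 / 2` expected
copies in `G(n, p)`. -/
def graphicFeasible {V : Type*} (n : ℕ) (H : SimpleGraph V) : Set I :=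
  {p | ∀ J : H.Subgraph, 1 / 2 ≤ expCopies n p J.coe}

/-- The probabilities `p ∈ [0, 1]` at which, for every subgraph `J` of `H`, the expected number of
copies of `J` in `G(n, p)` is at least half of the number of copies of `J` in `H`. -/
def fractionalFeasible {V : Type*} [Fintype V] (n : ℕ) (H : SimpleGraph V) : Set I :=
  {p | ∀ J : H.Subgraph, (H.copyCount J.coe : ℝ) / 2 ≤ expCopies n p J.coe}

/-- The graphic expectation threshold of `H` with respect to `G(n, p)`. The infimum is a minimum as soon as `H` has at most
`n` vertices, see `isLeast_graphicThreshold`. -/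
noncomputable def graphicThreshold {V : Type*} (n : ℕ) (H : SimpleGraph V) : I :=
  sInf (graphicFeasible n H)

/-- The fractional expectation threshold of `H` with respect to `G(n, p)`. The infimum is a minimum as soon as `H` has at most
`n` vertices, see `isLeast_fractionalThreshold`. -/
noncomputable def fractionalThreshold {V : Type*} [Fintype V] (n : ℕ) (H : SimpleGraph V) : I :=
  sInf (fractionalFeasible n H)

theorem measurableSingletonClass_simpleGraph (n : ℕ) :
    MeasurableSingletonClass (SimpleGraph (Fin n)) := by
  refine ⟨fun G => ?_⟩
  have h : ({G} : Set (SimpleGraph (Fin n))) = SimpleGraph.edgeSet ⁻¹' {G.edgeSet} := by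
    ext G'; simp
  rw [h]
  exact SimpleGraph.measurableEmbedding_edgeSet.measurable (measurableSet_singleton _)

theorem expCopies_eq_sum {W : Type*} (n : ℕ) (p : I) (J : SimpleGraph W) :
    expCopies n p J = ∑ G : SimpleGraph (Fin n),
      ((p : ℝ) ^ G.edgeSet.ncard * (1 - p : ℝ) ^ (n.choose 2 - G.edgeSet.ncard)) *
        (G.copyCount J : ℝ) := by
  have := measurableSingletonClass_simpleGraph n
  rw [expCopies, integral_fintype (.of_finite)]
  simp [measureReal_def]

theorem continuous_expCopies {W : Type*} (n : ℕ) (J : SimpleGraph W) :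
    Continuous fun p : I => expCopies n p J := by
  simp only [expCopies_eq_sum]
  fun_prop

theorem expCopies_one {W : Type*} (n : ℕ) (J : SimpleGraph W) :
    expCopies n 1 J = ((⊤ : SimpleGraph (Fin n)).copyCount J : ℝ) := by
  have := measurableSingletonClass_simpleGraph n
  simp [expCopies]

theorem copyCount_le_of_isContained {V V' W : Type*} [Fintype V] [Fintype V'] {H : SimpleGraph V}
    {G : SimpleGraph V'} (f : H.Copy G) (J : SimpleGraph W) :
    H.copyCount J ≤ G.copyCount J := by
  classical
  rw [SimpleGraph.copyCount, SimpleGraph.copyCount]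
  refine Finset.card_le_card_of_injOn (fun H' => H'.map f.toHom) ?_ ?_
  · intro H' hH'
    simp only [Finset.coe_filter, Finset.mem_univ, true_and, Set.mem_ofPred_eq] at hH' ⊢
    exact hH'.map fun e => (f.isoSubgraphMap H').comp e
  · have hl : Function.LeftInverse (SimpleGraph.Subgraph.comap f.toHom)
        (SimpleGraph.Subgraph.map f.toHom) := by
      intro H'
      ext a b
      · have h := fun x => f.injective.eq_iff (a := x) (b := a)
        simp only [SimpleGraph.Copy.coe_toHom] at h
        simp [h]
      · have := fun h : H'.Adj a b => h.adj_sub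
        simp only [SimpleGraph.Subgraph.comap_adj, SimpleGraph.Subgraph.map_adj,
          Relation.map_apply, f.injective.eq_iff]
        grind
    exact hl.injective.injOn

theorem isLeast_graphicThreshold {V : Type*} [Fintype V] (n : ℕ) (H : SimpleGraph V)
    (hn : Fintype.card V ≤ n) : IsLeast (graphicFeasible n H) (graphicThreshold n H) := by
  refine IsCompact.isLeast_sInf (IsClosed.isCompact ?_) ⟨1, fun J => ?_⟩
  · simp only [graphicFeasible, Set.ofPred_forall]
    exact isClosed_iInter fun J => isClosed_le continuous_const (continuous_expCopies n _)
  · rw [expCopies_one]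
    have h : J.coe ⊑ (⊤ : SimpleGraph (Fin n)) :=
      J.coe_isContained.trans (SimpleGraph.isContained_top_iff.2
        (Function.Embedding.nonempty_of_card_le (by simpa using hn)))
    have h1 : 0 < (⊤ : SimpleGraph (Fin n)).copyCount J.coe := SimpleGraph.copyCount_pos.2 h
    have : (1 : ℝ) ≤ (⊤ : SimpleGraph (Fin n)).copyCount J.coe := by exact_mod_cast h1
    linarith

theorem isLeast_fractionalThreshold {V : Type*} [Fintype V] (n : ℕ) (H : SimpleGraph V)
    (hn : Fintype.card V ≤ n) : IsLeast (fractionalFeasible n H) (fractionalThreshold n H) := by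
  refine IsCompact.isLeast_sInf (IsClosed.isCompact ?_) ⟨1, fun J => ?_⟩
  · simp only [fractionalFeasible, Set.ofPred_forall]
    exact isClosed_iInter fun J => isClosed_le continuous_const (continuous_expCopies n _)
  · rw [expCopies_one]
    obtain ⟨f⟩ : H ⊑ (⊤ : SimpleGraph (Fin n)) := SimpleGraph.isContained_top_iff.2
      (Function.Embedding.nonempty_of_card_le (by simpa using hn))
    have h : (H.copyCount J.coe : ℝ) ≤ (⊤ : SimpleGraph (Fin n)).copyCount J.coe := by
      exact_mod_cast copyCount_le_of_isContained f J.coe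
    have : (0 : ℝ) ≤ H.copyCount J.coe := by positivity
    linarith

/-!
If every subgraph of `H` has at least `1 / 2` expected copies in `G(n, p)`, then a subgraph of `H`
with `v` vertices and `e` edges has at most `2 * n ^ v * p ^ e` automorphisms. This limits the size
of sunflowers in `H`: permuting `t` petals gives `t!` automorphisms, so if the kernel has `r`
vertices and each petal adds `c` vertices and `k` edges, `t! ≤ 2 * n ^ r * (n ^ c * p ^ k) ^ t`.

For the first bound, sparsity and Hall's theorem give an orientation of `H` with out-degrees
`O(log n)` in which few edges have all their tails in a given set. The copies in `H` of a graph `F`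
whose edges receive a prescribed orientation pattern are built one strongly connected piece of the
pattern at a time. Given the vertices placed so far, the out-degree bound leaves few positions of a
piece through a given vertex, and pairwise disjoint positions form a sunflower.

For the second bound, `n * p ≤ 1 / 3` forces the connected subgraphs of `H` to be trees. The
sunflower bound with empty kernel limits how many components of `H` are isomorphic to a given tree,
and a double count over labelled trees limits the copies of a connected graph in the components of
order `v + 1`. The resulting bounds are summed as a geometric series in `v`.
-/

section ExpectationThresholds

open SimpleGraph ProbabilityTheory

variable {V W : Type*}

instance finite_copy [Finite V] [Finite W] (J : SimpleGraph W) (G : SimpleGraph V) :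
    Finite (J.Copy G) :=
  .of_injective (fun f : J.Copy G => (f : W → V)) DFunLike.coe_injective

instance finite_iso [Finite V] [Finite W] (J : SimpleGraph W) (G : SimpleGraph V) :
    Finite (J ≃g G) :=
  .of_injective (fun f : J ≃g G => (f : W → V)) DFunLike.coe_injective

theorem card_iso_eq_card_aut {J : SimpleGraph W} {G : SimpleGraph V} (e : J ≃g G) :
    Nat.card (J ≃g G) = Nat.card (J ≃g J) :=
  Nat.card_congr
    { toFun := fun f => f.trans e.symm
      invFun := fun f => f.trans e
      left_inv := fun f => by ext; simp
      right_inv := fun f => by ext; simp }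

theorem card_aut_congr {J : SimpleGraph W} {G : SimpleGraph V} (e : J ≃g G) :
    Nat.card (G ≃g G) = Nat.card (J ≃g J) :=
  Nat.card_congr
    { toFun := fun f => (e.trans f).trans e.symm
      invFun := fun f => (e.symm.trans f).trans e
      left_inv := fun f => by ext; simp
      right_inv := fun f => by ext; simp }

theorem card_aut_pos [Finite W] (J : SimpleGraph W) : 0 < Nat.card (J ≃g J) :=
  have : Nonempty (J ≃g J) := ⟨Iso.refl⟩
  Nat.card_pos

theorem toSubgraph_coeCopy_comp {J : SimpleGraph W} {G : SimpleGraph V} {S : G.Subgraph}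
    (e : J ≃g S.coe) : (S.coeCopy.comp e.toCopy).toSubgraph = S := by
  change Subgraph.map (S.hom.comp e.toHom) ⊤ = S
  simp [Subgraph.map_comp]

theorem card_copy_eq_copyCount_mul [Fintype V] [Finite W] (J : SimpleGraph W)
    (G : SimpleGraph V) : Nat.card (J.Copy G) = G.copyCount J * Nat.card (J ≃g J) := by
  classical
  let g : (Σ S : {S : G.Subgraph // Nonempty (J ≃g S.coe)}, J ≃g S.1.coe) → J.Copy G :=
    fun x => x.1.1.coeCopy.comp x.2.toCopy
  have hg : Function.Bijective g := by
    refine ⟨?_, fun f => ⟨⟨⟨f.toSubgraph, ⟨f.isoToSubgraph⟩⟩, f.isoToSubgraph⟩, rfl⟩⟩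
    rintro ⟨⟨S, hS⟩, e⟩ ⟨⟨S', hS'⟩, e'⟩ (h : S.coeCopy.comp e.toCopy = S'.coeCopy.comp e'.toCopy)
    obtain rfl : S = S' := by
      simpa only [toSubgraph_coeCopy_comp] using congrArg Copy.toSubgraph h
    obtain rfl : e = e' := RelIso.ext fun w => Subtype.ext (DFunLike.congr_fun h w)
    rfl
  rw [← Nat.card_eq_of_bijective g hg, Nat.card_sigma,
    Finset.sum_congr rfl fun S _ => card_iso_eq_card_aut S.2.some, Finset.sum_const,
    Finset.card_univ, smul_eq_mul, copyCount, Fintype.card_subtype]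

theorem binomialRandom_real_Ici [Finite V] (p : I) (S : SimpleGraph V) :
    (binomialRandom V p).real (Set.Ici S) = (p : ℝ) ^ S.edgeSet.ncard := by
  classical
  have := Fintype.ofFinite V
  have hedge : fromEdgeSet ⁻¹' Set.Ici S = {T : Set (Sym2 V) | S.edgeSet ⊆ T} := by
    ext T
    simp only [Set.mem_preimage, Set.mem_Ici, Set.mem_ofPred_eq, ← edgeSet_subset_edgeSet,
      edgeSet_fromEdgeSet, Set.subset_sdiff, and_iff_left_iff_imp]
    exact fun _ => Set.disjoint_left.2 fun e he => not_isDiag_of_mem_edgeSet S he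
  have hpi : (fun q : Sym2 V → Prop => {e | q e}) ⁻¹' {T | S.edgeSet ⊆ T} =
      Set.pi S.edgeFinset fun _ => {True} := by
    ext q
    simp [Set.subset_def, Set.pi]
  have hmeas : MeasurableSet (Set.Ici S) := by
    have h := measurable_edgeSet (Set.toFinite {T : Set (Sym2 V) | S.edgeSet ⊆ T}).measurableSet
    simpa [Set.preimage, Set.Ici] using h
  have hfactor : ∀ e ∈ S.edgeFinset, (toNNReal p • Measure.dirac (e ∈ Sym2.diagSetᶜ) +
      toNNReal (σ p) • Measure.dirac False) {True} = toNNReal p := by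
    intro e he
    have := not_isDiag_of_mem_edgeSet S (mem_edgeFinset.1 he)
    simp [this]
  rw [measureReal_def, binomialRandom_eq_map, Measure.map_apply measurable_fromEdgeSet hmeas,
    hedge, setBernoulli_apply', hpi,
    Measure.infinitePi_pi (X := fun _ : Sym2 V => Prop) _ fun _ _ => measurableSet_singleton _,
    Finset.prod_congr rfl hfactor]
  simp [← Set.ncard_coe_finset]

theorem card_copy_eq_card_map_le (J : SimpleGraph W) (G : SimpleGraph V) :
    Nat.card (J.Copy G) = Nat.card {f : W ↪ V // J.map f ≤ G} :=
  Nat.card_congr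
    { toFun := fun f => ⟨f.toEmbedding, by
        rintro _ _ ⟨_, a, b, h, rfl, rfl⟩; exact f.toHom.map_adj h⟩
      invFun := fun f => ⟨⟨f.1, fun {a b} h => f.2 (map_adj_apply.2 h)⟩, f.1.injective⟩
      left_inv := fun f => rfl
      right_inv := fun f => rfl }

theorem ncard_edgeSet_map (J : SimpleGraph W) (f : W ↪ V) :
    (J.map f).edgeSet.ncard = J.edgeSet.ncard := by
  rw [edgeSet_map, Set.ncard_image_of_injective _ f.sym2Map.injective]

theorem card_aut_mul_expCopies [Finite W] (n : ℕ) (p : I) (J : SimpleGraph W) :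
    (Nat.card (J ≃g J) : ℝ) * expCopies n p J =
      n.descFactorial (Nat.card W) * (p : ℝ) ^ J.edgeSet.ncard := by
  classical
  have := Fintype.ofFinite W
  have := measurableSingletonClass_simpleGraph n
  have hcount : ∀ G : SimpleGraph (Fin n), (Nat.card (J ≃g J) : ℝ) * G.copyCount J =
      ∑ f : W ↪ Fin n, (Set.Ici (J.map f)).indicator 1 G := by
    intro G
    rw [mul_comm, ← Nat.cast_mul, ← card_copy_eq_copyCount_mul, card_copy_eq_card_map_le,
      Nat.card_eq_fintype_card, Fintype.card_subtype]
    simp [Set.indicator_apply]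
  calc (Nat.card (J ≃g J) : ℝ) * expCopies n p J
    _ = ∫ G, ∑ f : W ↪ Fin n, (Set.Ici (J.map f)).indicator 1 G ∂binomialRandom (Fin n) p := by
      rw [expCopies, ← integral_const_mul]
      simp only [hcount]
    _ = ∑ _f : W ↪ Fin n, (p : ℝ) ^ J.edgeSet.ncard := by
      rw [integral_finsetSum _ fun _ _ => .of_finite]
      refine Finset.sum_congr rfl fun f _ => ?_
      rw [integral_indicator_one (Set.toFinite _).measurableSet, binomialRandom_real_Ici,
        ncard_edgeSet_map]
    _ = n.descFactorial (Nat.card W) * (p : ℝ) ^ J.edgeSet.ncard := by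
      simp [Fintype.card_embedding_eq]

/-- The sparsity of `H` at which it is graphically feasible: every subgraph of `H` has at least
`1 / 2` expected copies in `G(n, p)`. The count is over embeddings, which outnumber the copies of
`J` by the number of automorphisms of `J`, and `p` is any real, so that it may be rescaled. -/
def IsSparse (n : ℕ) (p : ℝ) (H : SimpleGraph V) : Prop :=
  ∀ J : H.Subgraph, (Nat.card (J.coe ≃g J.coe) : ℝ) / 2 ≤
    n.descFactorial (Nat.card J.verts) * p ^ J.coe.edgeSet.ncard

theorem isSparse_of_mem_graphicFeasible [Finite V] {n : ℕ} {p : I} {H : SimpleGraph V}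
    (hp : p ∈ graphicFeasible n H) : IsSparse n p H := by
  intro J
  rw [← card_aut_mul_expCopies]
  have hJ := mul_le_mul_of_nonneg_left (hp J) (Nat.cast_nonneg (Nat.card (J.coe ≃g J.coe)))
  linarith

theorem mem_fractionalFeasible_of_card_copy_le [Fintype V] {n : ℕ} {q : I} {H : SimpleGraph V}
    (h : ∀ J : H.Subgraph, (Nat.card (J.coe.Copy H) : ℝ) ≤
      n.descFactorial (Nat.card J.verts) * (q : ℝ) ^ J.coe.edgeSet.ncard) :
    q ∈ fractionalFeasible n H := by
  intro J
  have hJ := h J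
  rw [← card_aut_mul_expCopies, card_copy_eq_copyCount_mul, Nat.cast_mul, mul_comm] at hJ
  have hle := le_of_mul_le_mul_left hJ (by exact_mod_cast card_aut_pos J.coe)
  exact (half_le_self (Nat.cast_nonneg _)).trans hle

theorem IsSparse.mono {n : ℕ} {p q : ℝ} {H : SimpleGraph V} (hs : IsSparse n p H) (hp : 0 ≤ p)
    (hpq : p ≤ q) : IsSparse n q H := fun J =>
  (hs J).trans (by gcongr)

theorem ncard_edgeSet_congr {J : SimpleGraph W} {G : SimpleGraph V} (e : J ≃g G) :
    J.edgeSet.ncard = G.edgeSet.ncard := by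
  simpa only [Nat.card_coe_set_eq] using Nat.card_congr e.mapEdgeSet

theorem IsSparse.card_aut_le [Finite W] {n : ℕ} {p : ℝ} {H : SimpleGraph V}
    (hs : IsSparse n p H) (hp : 0 ≤ p) {P : SimpleGraph W} (f : P.Copy H) :
    (Nat.card (P ≃g P) : ℝ) ≤ 2 * ((n : ℝ) ^ Nat.card W * p ^ P.edgeSet.ncard) := by
  have e := f.isoToSubgraph
  have h := hs f.toSubgraph
  rw [card_aut_congr e, ← ncard_edgeSet_congr e, ← Nat.card_congr e.toEquiv] at h
  have hn : (n.descFactorial (Nat.card W) : ℝ) * p ^ P.edgeSet.ncard ≤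
      (n : ℝ) ^ Nat.card W * p ^ P.edgeSet.ncard := by
    gcongr
    exact_mod_cast Nat.descFactorial_le_pow _ _
  linarith

theorem IsSparse.one_le [Finite W] {n : ℕ} {p : ℝ} {H : SimpleGraph V}
    (hs : IsSparse n p H) (hp : 0 ≤ p) {P : SimpleGraph W} (f : P.Copy H) :
    1 ≤ 2 * ((n : ℝ) ^ Nat.card W * p ^ P.edgeSet.ncard) :=
  le_trans (by exact_mod_cast card_aut_pos P) (hs.card_aut_le hp f)

/-! ### Sunflowers -/

section Sunflower

variable {R C ι : Type*}

/-- The inclusion of the pattern `R ⊕ C` as the petal with index `i` of a sunflower. -/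
def petal (R C : Type*) {ι : Type*} (i : ι) : R ⊕ C ↪ R ⊕ ι × C :=
  (Function.Embedding.refl R).sumMap ⟨Prod.mk i, Prod.mk_right_injective i⟩

/-- The sunflower with one petal for each `i : ι`: the union of copies of `Q` glued along the kernel
`R`, with a separate copy of `C` for each petal. -/
def sunflower (Q : SimpleGraph (R ⊕ C)) (ι : Type*) : SimpleGraph (R ⊕ ι × C) :=
  ⨆ i : ι, Q.map (petal R C i)

theorem sunflower_adj {Q : SimpleGraph (R ⊕ C)} {x y : R ⊕ ι × C} :
    (sunflower Q ι).Adj x y ↔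
      ∃ i a b, Q.Adj a b ∧ petal R C i a = x ∧ petal R C i b = y := by
  simp only [sunflower, iSup_adj, map_adj]

theorem eq_of_petal_inr_eq {i j : ι} {c : C} {x : R ⊕ C}
    (h : petal R C i (.inr c) = petal R C j x) : i = j := by
  rcases x with x | x
  · simp [petal] at h
  · exact congrArg Prod.fst (Sum.inr_injective h)

theorem exists_inr_mem_of_mem_edgeSet {Q : SimpleGraph (R ⊕ C)}
    (hQ : ∀ r r', ¬ Q.Adj (.inl r) (.inl r')) {e : Sym2 (R ⊕ C)} (he : e ∈ Q.edgeSet) :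
    ∃ c, Sum.inr c ∈ e := by
  induction e with | _ a b
  rcases a with a | a
  · rcases b with b | b
    · exact (hQ _ _ he).elim
    · exact ⟨b, by simp⟩
  · exact ⟨a, by simp⟩

theorem card_mul_ncard_edgeSet_le_sunflower [Finite R] [Finite C] [Finite ι]
    {Q : SimpleGraph (R ⊕ C)} (hQ : ∀ r r', ¬ Q.Adj (.inl r) (.inl r')) :
    Nat.card ι * Q.edgeSet.ncard ≤ (sunflower Q ι).edgeSet.ncard := by
  let g : ι × Q.edgeSet → (sunflower Q ι).edgeSet := fun x =>
    ⟨Sym2.map (petal R C x.1) x.2.1, by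
      obtain ⟨i, e, he⟩ := x
      induction e with | _ a b
      exact sunflower_adj.2 ⟨i, a, b, he, rfl, rfl⟩⟩
  have hg : Function.Injective g := by
    rintro ⟨i, e, he⟩ ⟨j, e', he'⟩ h
    have h : Sym2.map (petal R C i) e = Sym2.map (petal R C j) e' := congrArg Subtype.val h
    obtain ⟨c, hc⟩ := exists_inr_mem_of_mem_edgeSet hQ he
    obtain ⟨x, -, hx⟩ := Sym2.mem_map.1 (h ▸ Sym2.mem_map.2 ⟨_, hc, rfl⟩)
    obtain rfl := eq_of_petal_inr_eq hx.symm
    obtain rfl := Sym2.map.injective (petal R C i).injective h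
    rfl
  simpa [Nat.card_prod, Nat.card_coe_set_eq] using Nat.card_le_card_of_injective g hg

/-- The automorphisms of `Q` relative to the kernel `R`, encoded as the permutations of `C` whose
extension by the identity on `R` preserves adjacency. -/
abbrev RelAut (Q : SimpleGraph (R ⊕ C)) : Type _ :=
  {τ : Equiv.Perm C // ∀ x y, Q.Adj (Sum.map id τ x) (Sum.map id τ y) ↔ Q.Adj x y}

theorem card_relAut_pos [Finite C] (Q : SimpleGraph (R ⊕ C)) : 0 < Nat.card (RelAut Q) :=
  have : Nonempty (RelAut Q) := ⟨1, by simp⟩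
  Nat.card_pos

/-- The automorphism of a sunflower that permutes the petals by `π` and acts on the petal with
index `i` by `τ i`. -/
def sunflowerAut (Q : SimpleGraph (R ⊕ C)) (π : Equiv.Perm ι) (τ : ι → RelAut Q) :
    sunflower Q ι ≃g sunflower Q ι where
  toEquiv := Equiv.sumCongr (Equiv.refl R) (Equiv.prodShear π fun i => (τ i).1)
  map_rel_iff' {u v} := by
    set E := Equiv.sumCongr (Equiv.refl R) (Equiv.prodShear π fun i => (τ i).1)
    have hE : ∀ i x, petal R C (π i) (Sum.map id (τ i).1 x) = E (petal R C i x) := by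
      rintro i (x | x) <;> rfl
    have hs : ∀ i, Function.Surjective (Sum.map id (τ i).1 : R ⊕ C → R ⊕ C) := fun i =>
      Function.surjective_id.sumMap (τ i).1.surjective
    rw [sunflower_adj, sunflower_adj, π.surjective.exists]
    refine exists_congr fun i => (hs i).exists.trans <| exists_congr fun a =>
      (hs i).exists.trans <| exists_congr fun b => ?_
    rw [(τ i).2, hE, hE, E.injective.eq_iff, E.injective.eq_iff]

theorem factorial_mul_card_relAut_pow_le [Finite R] [Finite C] [Nonempty C] [Finite ι]
    (Q : SimpleGraph (R ⊕ C)) :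
    (Nat.card ι).factorial * Nat.card (RelAut Q) ^ Nat.card ι ≤
      Nat.card (sunflower Q ι ≃g sunflower Q ι) := by
  have hg : Function.Injective fun x : Equiv.Perm ι × (ι → RelAut Q) =>
      sunflowerAut Q x.1 x.2 := by
    rintro ⟨π, τ⟩ ⟨π', τ'⟩ h
    have hc : ∀ i c, (π i, (τ i).1 c) = (π' i, (τ' i).1 c) := fun i c =>
      Sum.inr_injective (DFunLike.congr_fun h (.inr (i, c)))
    obtain rfl : π = π' := Equiv.ext fun i => congrArg Prod.fst (hc i (Classical.arbitrary C))
    obtain rfl : τ = τ' :=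
      funext fun i => Subtype.ext <| Equiv.ext fun c => congrArg Prod.snd (hc i c)
    rfl
  simpa [Nat.card_prod, Nat.card_perm, Nat.card_fun] using Nat.card_le_card_of_injective _ hg

/-- The sunflower formed by copies of `Q` that agree on the kernel and are disjoint outside it. -/
noncomputable def sunflowerCopy [Nonempty ι] {Q : SimpleGraph (R ⊕ C)} {H : SimpleGraph V}
    (f : ι → Q.Copy H) (hker : ∀ i j r, f i (.inl r) = f j (.inl r))
    (hdisj : ∀ i j c c', f i (.inr c) = f j (.inr c') → i = j) : (sunflower Q ι).Copy H where
  toHom :=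
    { toFun := Sum.elim (fun r => f (Classical.arbitrary ι) (.inl r)) fun x => f x.1 (.inr x.2)
      map_rel' := by
        intro x y h
        obtain ⟨i, a, b, hab, rfl, rfl⟩ := sunflower_adj.1 h
        have hf : ∀ a, Sum.elim (fun r => f (Classical.arbitrary ι) (.inl r))
            (fun x => f x.1 (.inr x.2)) (petal R C i a) = f i a := by
          rintro (a | a)
          · exact hker _ _ a
          · rfl
        rw [hf, hf]
        exact (f i).toHom.map_adj hab }
  injective' := by
    refine Function.Injective.sumElim (fun r r' h => ?_) ?_ fun r x h => ?_
    · exact Sum.inl_injective ((f _).injective h)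
    · rintro ⟨i, c⟩ ⟨j, c'⟩ h
      obtain rfl := hdisj _ _ _ _ h
      exact congrArg (Prod.mk i) (Sum.inr_injective ((f i).injective h))
    · rw [hker _ x.1] at h
      exact Sum.inl_ne_inr ((f x.1).injective h)

variable {n : ℕ} {p : ℝ} {H : SimpleGraph V}

theorem IsSparse.factorial_mul_card_relAut_pow_le [Finite R] [Finite C] [Nonempty C] [Finite ι]
    [Nonempty ι] (hs : IsSparse n p H) (hp : 0 ≤ p) (hp1 : p ≤ 1) {Q : SimpleGraph (R ⊕ C)}
    (hQ : ∀ r r', ¬ Q.Adj (.inl r) (.inl r')) (f : ι → Q.Copy H)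
    (hker : ∀ i j r, f i (.inl r) = f j (.inl r))
    (hdisj : ∀ i j c c', f i (.inr c) = f j (.inr c') → i = j) :
    ((Nat.card ι).factorial : ℝ) * (Nat.card (RelAut Q) : ℝ) ^ Nat.card ι ≤
      2 * (n : ℝ) ^ Nat.card R * ((n : ℝ) ^ Nat.card C * p ^ Q.edgeSet.ncard) ^ Nat.card ι := by
  have hcard : Nat.card (R ⊕ ι × C) = Nat.card R + Nat.card C * Nat.card ι := by
    rw [Nat.card_sum, Nat.card_prod, mul_comm]
  calc ((Nat.card ι).factorial : ℝ) * (Nat.card (RelAut Q) : ℝ) ^ Nat.card ι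
    _ ≤ Nat.card (sunflower Q ι ≃g sunflower Q ι) := by
      exact_mod_cast _root_.factorial_mul_card_relAut_pow_le Q
    _ ≤ 2 * ((n : ℝ) ^ Nat.card (R ⊕ ι × C) * p ^ (sunflower Q ι).edgeSet.ncard) :=
      hs.card_aut_le hp (sunflowerCopy f hker hdisj)
    _ ≤ 2 * ((n : ℝ) ^ (Nat.card R + Nat.card C * Nat.card ι) *
          p ^ (Nat.card ι * Q.edgeSet.ncard)) := by
      rw [hcard]
      gcongr 2 * (_ * ?_)
      exact pow_le_pow_of_le_one hp hp1 (card_mul_ncard_edgeSet_le_sunflower hQ)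
    _ = 2 * (n : ℝ) ^ Nat.card R * ((n : ℝ) ^ Nat.card C * p ^ Q.edgeSet.ncard) ^ Nat.card ι := by
      rw [mul_comm (Nat.card ι), pow_add, pow_mul, pow_mul, mul_pow]
      ring

theorem IsSparse.factorial_mul_card_aut_pow_le [Finite C] [Nonempty C] [Finite ι]
    (hs : IsSparse n p H) (hp : 0 ≤ p) (hp1 : p ≤ 1) {L : SimpleGraph C} (f : ι → L.Copy H)
    (hdisj : ∀ i j c c', f i c = f j c' → i = j) :
    ((Nat.card ι).factorial : ℝ) * (Nat.card (L ≃g L) : ℝ) ^ Nat.card ι ≤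
      2 * ((n : ℝ) ^ Nat.card C * p ^ L.edgeSet.ncard) ^ Nat.card ι := by
  rcases isEmpty_or_nonempty ι with _ | _
  · simp
  let e := Iso.comap (Equiv.emptySum Empty C) L
  have hrel : Nat.card (L ≃g L) ≤ Nat.card (RelAut (L.comap (Equiv.emptySum Empty C))) := by
    refine Nat.card_le_card_of_injective (fun τ => ⟨τ.toEquiv, ?_⟩) fun τ τ' h =>
      RelIso.ext fun c => DFunLike.congr_fun (congrArg Subtype.val h) c
    rintro (x | x) (y | y)
    exacts [x.elim, x.elim, y.elim, τ.map_adj_iff]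
  have h := hs.factorial_mul_card_relAut_pow_le hp hp1 (fun r => r.elim)
    (fun i => (f i).comp e.toCopy) (fun _ _ r => r.elim) fun i j c c' => hdisj i j c c'
  rw [ncard_edgeSet_congr e, Nat.card_of_isEmpty (α := Empty), pow_zero, mul_one] at h
  refine le_trans ?_ h
  gcongr

end Sunflower

theorem pow_self_le_three_pow_mul_factorial (t : ℕ) : (t : ℝ) ^ t ≤ 3 ^ t * t.factorial := by
  have h := Real.pow_div_factorial_le_exp (t : ℝ) (by positivity) t
  rw [div_le_iff₀ (by positivity), ← Real.exp_one_pow] at h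
  exact h.trans (by gcongr; exact Real.exp_one_lt_three.le)

theorem le_of_factorial_le {t m : ℕ} {y : ℝ} (hy : 0 ≤ y)
    (h : (t.factorial : ℝ) ≤ 2 * 2 ^ m * y ^ t) : (t : ℝ) ≤ 6 * y ∨ t ≤ m + 1 := by
  by_contra! ⟨hyt, hmt⟩
  have hle : (2 : ℝ) ^ t * (t : ℝ) ^ t ≤ 2 ^ (m + 1) * (t : ℝ) ^ t := by
    calc (2 : ℝ) ^ t * (t : ℝ) ^ t
      _ ≤ 2 ^ t * (3 ^ t * (2 * 2 ^ m * y ^ t)) := by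
        gcongr
        exact (pow_self_le_three_pow_mul_factorial t).trans (by gcongr)
      _ = 2 ^ (m + 1) * (6 * y) ^ t := by
        rw [show (6 : ℝ) * y = 2 * (3 * y) by ring, mul_pow, mul_pow, pow_succ]
        ring
      _ ≤ 2 ^ (m + 1) * (t : ℝ) ^ t := by gcongr
  have hpos : (0 : ℝ) < (t : ℝ) ^ t := pow_pos (Nat.cast_pos.2 (by omega)) _
  exact (pow_lt_pow_right₀ (one_lt_two (α := ℝ)) hmt).not_ge (le_of_mul_le_mul_right hle hpos)

/-! ### Balanced orientations -/

/-- The edges of `F` with both endpoints in `U`, as unordered pairs of vertices of `F` and not of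
`U`, so that the edges inside different sets can be compared. -/
def edgesIn (F : SimpleGraph W) (U : Finset W) : Set (Sym2 W) :=
  {e | e ∈ F.edgeSet ∧ ∀ w ∈ e, w ∈ U}

theorem ncard_edgesIn (F : SimpleGraph W) (U : Finset W) :
    (edgesIn F U).ncard = (F.induce (U : Set W)).edgeSet.ncard := by
  have h : edgesIn F U = Sym2.map Subtype.val '' (F.induce (U : Set W)).edgeSet := by
    ext e
    constructor
    · rintro ⟨he, hU⟩
      induction e with | _ u v
      exact ⟨s(⟨u, hU u (by simp)⟩, ⟨v, hU v (by simp)⟩), he, rfl⟩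
    · rintro ⟨e, he, rfl⟩
      induction e with | _ u v
      exact ⟨he, by simp⟩
  rw [h, Set.ncard_image_of_injective _ (Sym2.map.injective Subtype.val_injective)]

theorem IsSparse.mul_ncard_edgeSet_le [Finite W] {n a b : ℕ} {H : SimpleGraph V}
    (hs : IsSparse n ((2 : ℝ)⁻¹ ^ b) H) (ha : 2 * n ≤ 2 ^ a) {P : SimpleGraph W} (f : P.Copy H) :
    b * P.edgeSet.ncard ≤ a * Nat.card W := by
  rcases isEmpty_or_nonempty W with _ | _
  · simp [Set.eq_empty_of_isEmpty]
  have h := hs.one_le (by positivity) f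
  rw [← pow_mul, inv_pow, ← mul_assoc, ← div_eq_mul_inv, le_div_iff₀ (by positivity), one_mul] at h
  refine (pow_le_pow_iff_right₀ (one_lt_two (α := ℝ))).1 ?_
  calc (2 : ℝ) ^ (b * P.edgeSet.ncard)
    _ ≤ 2 * n ^ Nat.card W := h
    _ ≤ 2 ^ Nat.card W * n ^ Nat.card W := by
      gcongr
      exact le_self_pow₀ one_le_two Nat.card_pos.ne'
    _ ≤ (2 ^ a) ^ Nat.card W := by
      rw [← mul_pow]
      gcongr
      exact_mod_cast ha
    _ = 2 ^ (a * Nat.card W) := (pow_mul ..).symm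

theorem IsSparse.mul_ncard_edgesIn_le {n a b : ℕ} {H : SimpleGraph V}
    (hs : IsSparse n ((2 : ℝ)⁻¹ ^ b) H) (ha : 2 * n ≤ 2 ^ a) (U : Finset V) :
    b * (edgesIn H U).ncard ≤ a * U.card := by
  simpa [ncard_edgesIn] using hs.mul_ncard_edgeSet_le ha (Copy.induce H (U : Set V))

/-- A relation `arc` orienting part of the edges of `H`, possibly in both directions, with
out-degrees at most `a` and such that `b` times the number of edges all of whose tails lie in `C`
is at most `a * |C|`. -/
structure IsBalancedOrientation (H : SimpleGraph V) (a b : ℕ) (arc : V → V → Prop) : Prop where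
  ncard_arc_le : ∀ u, {v | arc u v}.ncard ≤ a
  mul_ncard_le : ∀ E ⊆ H.edgeSet, ∀ C : Set V,
    (∀ u v, s(u, v) ∈ E → arc u v → u ∈ C) → b * E.ncard ≤ a * C.ncard

theorem exists_injective_mem_edge [Finite V] {H : SimpleGraph V} {a b : ℕ}
    (hH : ∀ U : Finset V, b * (edgesIn H U).ncard ≤ a * U.card) :
    ∃ f : H.edgeSet × Fin b → V × Fin a, Function.Injective f ∧ ∀ x, (f x).1 ∈ x.1.1 := by
  classical
  have := Fintype.ofFinite V
  suffices hall : ∀ s : Finset (H.edgeSet × Fin b), s.card ≤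
      (s.biUnion fun x => x.1.1.toFinset ×ˢ (Finset.univ : Finset (Fin a))).card by
    obtain ⟨f, hf, hmem⟩ := (Finset.all_card_le_biUnion_card_iff_exists_injective _).1 hall
    exact ⟨f, hf, fun x => by simpa using hmem x⟩
  intro s
  let U : Finset V := s.biUnion fun x => x.1.1.toFinset
  have hbiUnion : (s.biUnion fun x => x.1.1.toFinset ×ˢ (Finset.univ : Finset (Fin a))) =
      U ×ˢ Finset.univ := by
    ext ⟨u, i⟩
    simp [U]
  calc s.card
    _ ≤ ((edgesIn H U).toFinset ×ˢ (Finset.univ : Finset (Fin b))).card := by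
      refine Finset.card_le_card_of_injOn (fun x => (x.1.1, x.2)) (fun x hx => ?_) ?_
      · have hU : ∀ w ∈ x.1.1, w ∈ U := fun w hw =>
          Finset.mem_biUnion.2 ⟨x, hx, Sym2.mem_toFinset.2 hw⟩
        simpa using ⟨x.1.2, hU⟩
      · exact (Subtype.val_injective.prodMap Function.injective_id).injOn
    _ = b * (edgesIn H U).ncard := by
      rw [Finset.card_product, Finset.card_univ, Fintype.card_fin, mul_comm,
        Set.ncard_eq_toFinset_card']
    _ ≤ a * U.card := hH U
    _ = (s.biUnion fun x => x.1.1.toFinset ×ˢ (Finset.univ : Finset (Fin a))).card := by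
      rw [hbiUnion, Finset.card_product, Finset.card_univ, Fintype.card_fin, mul_comm]

theorem exists_isBalancedOrientation [Finite V] {H : SimpleGraph V} {a b : ℕ}
    (hH : ∀ U : Finset V, b * (edgesIn H U).ncard ≤ a * U.card) :
    ∃ arc, IsBalancedOrientation H a b arc := by
  -- Each edge owns `b` tokens and each vertex `a` slots; `u → v` is an arc if one of the tokens
  -- of `uv` is placed at `u`.
  obtain ⟨f, hf, hmem⟩ := exists_injective_mem_edge hH
  refine ⟨fun u v => ∃ h : H.Adj u v, ∃ i, (f (⟨s(u, v), h⟩, i)).1 = u, fun u => ?_,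
    fun E hE C hC => ?_⟩
  · choose h i hi using fun v : {v | ∃ h : H.Adj u v, ∃ i, (f (⟨s(u, v), h⟩, i)).1 = u} => v.2
    have hinj : Function.Injective fun v => (f (⟨s(u, v.1), (mem_edgeSet H).2 (h v)⟩, i v)).2 := by
      intro v w hvw
      have hslot := hf (Prod.ext ((hi v).trans (hi w).symm) hvw)
      exact Subtype.ext (Sym2.congr_right.1 (congrArg (fun x => x.1.1) hslot))
    simpa [← Nat.card_coe_set_eq] using Nat.card_le_card_of_injective _ hinj
  · have hmemC : ∀ e (he : e ∈ H.edgeSet) i u, (f (⟨e, he⟩, i)).1 = u → e ∈ E → u ∈ C := by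
      intro e he i u hu heE
      obtain ⟨v, rfl⟩ := Sym2.mem_iff_exists.1 (hu ▸ hmem (⟨e, he⟩, i))
      exact hC u v heE ⟨he, i, hu⟩
    let g : E × Fin b → C × Fin a := fun x =>
      (⟨(f (⟨x.1.1, hE x.1.2⟩, x.2)).1, hmemC _ _ _ _ rfl x.1.2⟩, (f (⟨x.1.1, hE x.1.2⟩, x.2)).2)
    have hg : Function.Injective g := by
      rintro ⟨⟨e, he⟩, i⟩ ⟨⟨e', he'⟩, i'⟩ h
      have hslot := Prod.ext_iff.1 h
      simpa using hf (Prod.ext (congrArg Subtype.val hslot.1) hslot.2)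
    simpa [Nat.card_prod, Nat.card_coe_set_eq, mul_comm] using Nat.card_le_card_of_injective g hg

theorem card_image_restrict_union_le [DecidableEq W] [DecidableEq V] {α : Type*}
    (X : Finset α) (f : α → W → V) (U C : Finset W) (T : ℕ) (hT : ∀ x ∈ X,
      ((X.filter fun y => U.restrict (f y) = U.restrict (f x)).image fun y => C.restrict (f y)).card
        ≤ T) :
    (X.image fun x => (U ∪ C).restrict (f x)).card ≤
      T * (X.image fun x => U.restrict (f x)).card := by
  let res : (↥(U ∪ C) → V) → U → V := Finset.restrict₂ (π := fun _ => V) Finset.subset_union_left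
  refine Finset.card_le_mul_card_image_of_maps_to (f := res) ?_ T fun b hb => ?_
  · intro z hz
    obtain ⟨x, hx, rfl⟩ := Finset.mem_image.1 hz
    exact Finset.mem_image_of_mem _ hx
  · obtain ⟨x, hx, rfl⟩ := Finset.mem_image.1 hb
    refine le_trans (Finset.card_le_card_of_injOn
      (Finset.restrict₂ (π := fun _ => V) Finset.subset_union_right) ?_ ?_) (hT x hx)
    · intro z hz
      obtain ⟨hz, hzx⟩ := Finset.mem_filter.1 hz
      obtain ⟨y, hy, rfl⟩ := Finset.mem_image.1 hz
      exact Finset.mem_image_of_mem _ (Finset.mem_filter.2 ⟨hy, hzx⟩)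
    · intro z hz z' hz' hC
      have hU : res z = res z' :=
        (Finset.mem_filter.1 hz).2.trans (Finset.mem_filter.1 hz').2.symm
      funext ⟨w, hw⟩
      rcases Finset.mem_union.1 hw with h | h
      · exact congrFun hU ⟨w, h⟩
      · exact congrFun hC ⟨w, h⟩

theorem exists_card_image_restrict_le_pow [Fintype W] [Finite V] [DecidableEq V]
    {arc : V → V → Prop} {a : ℕ} (ha : ∀ u, {v | arc u v}.ncard ≤ a) {D : W → W → Prop} {w₀ : W}
    (hD : ∀ w, Relation.ReflTransGen D w₀ w) {Z : Finset (W → V)} {v₀ : V}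
    (hZ₀ : ∀ z ∈ Z, z w₀ = v₀) (hZ : ∀ z ∈ Z, ∀ w w', D w w' → arc (z w) (z w')) :
    ∀ k < Fintype.card W, ∃ S : Finset W, S.card = k + 1 ∧ w₀ ∈ S ∧
      (Z.image S.restrict).card ≤ a ^ k := by
  classical
  intro k
  induction k with
  | zero =>
    refine fun _ => ⟨{w₀}, by simp, by simp, Finset.card_le_one.2 ?_⟩
    simp only [Finset.mem_image]
    rintro _ ⟨z, hz, rfl⟩ _ ⟨z', hz', rfl⟩
    funext ⟨w, hw⟩
    obtain rfl := Finset.mem_singleton.1 hw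
    exact (hZ₀ z hz).trans (hZ₀ z' hz').symm
  | succ k ih =>
    intro hk
    obtain ⟨S, hS, h₀, hcard⟩ := ih (by omega)
    obtain ⟨w, hw, w', hw', hww'⟩ : ∃ w ∈ S, ∃ w' ∉ S, D w w' := by
      by_contra! hclosed
      have hall : ∀ w, w ∈ S := fun w => by
        induction hD w with
        | refl => exact h₀
        | tail _ h ih => exact not_imp_not.1 (fun hn => hclosed _ ih _ hn) h
      rw [Finset.eq_univ_iff_forall.2 hall, Finset.card_univ] at hS
      omega
    refine ⟨S ∪ {w'}, by simp [hw', hS], Finset.mem_union_left _ h₀, ?_⟩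
    rw [pow_succ']
    refine (card_image_restrict_union_le Z id S {w'} a fun z _ => ?_).trans (by gcongr; exact hcard)
    refine le_trans ?_ (ha (z w))
    rw [Set.ncard_eq_toFinset_card _ (Set.toFinite _)]
    refine Finset.card_le_card_of_injOn (fun y => y ⟨w', by simp⟩) ?_ ?_
    · intro y hy
      obtain ⟨z', hz', rfl⟩ := Finset.mem_image.1 hy
      obtain ⟨hz', hzz'⟩ := Finset.mem_filter.1 hz'
      have : z' w = z w := congrFun hzz' ⟨w, hw⟩
      simpa [← this] using hZ z' hz' _ _ hww'
    · intro y _ y' _ h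
      funext ⟨c, hc⟩
      obtain rfl := Finset.mem_singleton.1 hc
      exact h

theorem card_le_pow_of_reachable [Fintype W] [Finite V] {arc : V → V → Prop} {a : ℕ}
    (ha : ∀ u, {v | arc u v}.ncard ≤ a) {D : W → W → Prop} {w₀ : W}
    (hD : ∀ w, Relation.ReflTransGen D w₀ w) {Z : Finset (W → V)} {v₀ : V}
    (hZ₀ : ∀ z ∈ Z, z w₀ = v₀) (hZ : ∀ z ∈ Z, ∀ w w', D w w' → arc (z w) (z w')) :
    Z.card ≤ a ^ (Fintype.card W - 1) := by
  classical
  have hW : 0 < Fintype.card W := Fintype.card_pos_iff.2 ⟨w₀⟩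
  obtain ⟨S, hS, -, hcard⟩ :=
    exists_card_image_restrict_le_pow ha hD hZ₀ hZ (Fintype.card W - 1) (by omega)
  obtain rfl : S = Finset.univ := (Finset.card_eq_iff_eq_univ S).1 (by omega)
  rwa [Finset.card_image_of_injective] at hcard
  exact fun z z' h => funext fun w => congrFun h ⟨w, Finset.mem_univ w⟩

theorem exists_disjoint_subfamily [Fintype W] [Nonempty W] [DecidableEq V]
    (Z : Finset (W → V)) (B : ℕ) (hB : ∀ w x, (Z.filter fun z => z w = x).card ≤ B) :
    ∃ M ⊆ Z, (∀ z ∈ M, ∀ z' ∈ M, ∀ w w', z w = z' w' → z = z') ∧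
      Z.card ≤ M.card * (Fintype.card W * (Fintype.card W * B)) := by
  classical
  let S := Z.powerset.filter fun M => ∀ z ∈ M, ∀ z' ∈ M, ∀ w w', z w = z' w' → z = z'
  obtain ⟨M, hM, hmax⟩ := S.exists_max_image Finset.card ⟨∅, by simp [S]⟩
  simp only [S, Finset.mem_filter, Finset.mem_powerset] at hM hmax
  refine ⟨M, hM.1, hM.2, ?_⟩
  have hcover : Z ⊆ M.biUnion fun m => Finset.univ.biUnion fun w : W =>
      Finset.univ.biUnion fun w' : W => Z.filter fun z => z w = m w' := by
    intro z hz
    simp only [Finset.mem_biUnion, Finset.mem_univ, true_and, Finset.mem_filter]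
    by_contra! hdisj
    have hzM : z ∉ M := fun h => hdisj z h (Classical.arbitrary W) (Classical.arbitrary W) hz rfl
    have hins := hmax (insert z M) ⟨Finset.insert_subset hz hM.1, by
      intro x hx y hy w w' h
      rcases Finset.mem_insert.1 hx with rfl | hxM <;> rcases Finset.mem_insert.1 hy with rfl | hyM
      · rfl
      · exact (hdisj y hyM w w' hz h).elim
      · exact (hdisj x hxM w' w hz h.symm).elim
      · exact hM.2 x hxM y hyM w w' h⟩
    rw [Finset.card_insert_of_notMem hzM] at hins
    omega
  refine (Finset.card_le_card hcover).trans (Finset.card_biUnion_le_card_mul _ _ _ fun m _ => ?_)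
  refine Finset.card_biUnion_le_card_mul _ _ _ fun w _ => ?_
  exact Finset.card_biUnion_le_card_mul _ _ _ fun w' _ => hB w _

/-- `U` is closed under out-neighbours of the relation `D`, i.e. it is a union of strongly connected
components that no arc leaves. -/
def IsOutClosed (D : W → W → Prop) (U : Finset W) : Prop :=
  ∀ ⦃w w'⦄, w ∈ U → D w w' → w' ∈ U

/-- Strong connectivity of the subgraph of the digraph `D` induced on `C`: any two elements of `C`
are joined by a directed path inside `C`. -/
def IsStronglyConnected (D : W → W → Prop) (C : Finset W) : Prop :=
  ∀ c c' : C, Relation.ReflTransGen (fun x y : C => D x y) c c'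

theorem IsOutClosed.exists_isStronglyConnected [Fintype W] [DecidableEq W] {D : W → W → Prop}
    {U : Finset W} (hU : IsOutClosed D U) (hne : U ≠ Finset.univ) :
    ∃ C : Finset W, C.Nonempty ∧ Disjoint U C ∧ IsOutClosed D (U ∪ C) ∧
      IsStronglyConnected D C := by
  classical
  -- A vertex outside `U` whose set of reachable vertices outside `U` is smallest lies in a
  -- terminal strongly connected component of the complement of `U`, namely that set.
  let R := Relation.ReflTransGen fun x y => D x y ∧ y ∉ U
  obtain ⟨w, hw, hmin⟩ := (Finset.univ \ U).exists_min_image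
    (fun w => (Finset.univ.filter (R w)).card) (by simpa [Finset.sdiff_nonempty] using hne)
  have hnotMem : ∀ {x y}, R x y → x ∉ U → y ∉ U := by
    intro x y h hx
    induction h with
    | refl => exact hx
    | tail _ h _ => exact h.2
  have hwU : w ∉ U := by simpa using hw
  have hback : ∀ {x}, R w x → R x w := by
    intro x hx
    have hsub : Finset.univ.filter (R x) ⊆ Finset.univ.filter (R w) := fun y hy => by
      simpa using hx.trans (Finset.mem_filter.1 hy).2
    have heq := Finset.eq_of_subset_of_card_le hsub (hmin x (by simpa using hnotMem hx hwU))
    have hmem : w ∈ Finset.univ.filter (R w) := by simpa using .refl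
    exact (Finset.mem_filter.1 (heq ▸ hmem)).2
  refine ⟨Finset.univ.filter (R w), ⟨w, by simpa using .refl⟩, ?_, ?_, ?_⟩
  · exact Finset.disjoint_right.2 fun x hx => hnotMem (Finset.mem_filter.1 hx).2 hwU
  · intro x y hx hxy
    by_cases hy : y ∈ U
    · exact Finset.mem_union_left _ hy
    have hx : R w x := by simpa using (Finset.mem_union.1 hx).resolve_left fun h => hy (hU h hxy)
    exact Finset.mem_union_right _ (by simpa using hx.tail ⟨hxy, hy⟩)
  · rintro ⟨c, hc⟩ ⟨c', hc'⟩
    have hcc' : R c c' := (hback (by simpa using hc)).trans (by simpa using hc')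
    induction hcc' using Relation.ReflTransGen.head_induction_on with
    | refl => exact .refl
    | @head x y hxy _ ih =>
      have hy : R w y := .tail (by simpa using hc) hxy
      exact .head (b := ⟨y, by simpa using hy⟩) hxy.1 (ih _)

theorem isOutClosed_induction [Fintype W] [DecidableEq W] (D : W → W → Prop)
    {P : Finset W → Prop} (empty : P ∅)
    (union : ∀ U C, IsOutClosed D U → C.Nonempty → Disjoint U C → IsStronglyConnected D C →
      P U → P (U ∪ C)) : P Finset.univ := by
  classical
  obtain ⟨U, hU, hmax⟩ := (Finset.univ.filter fun U => IsOutClosed D U ∧ P U).exists_max_image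
    Finset.card ⟨∅, Finset.mem_filter.2 ⟨Finset.mem_univ _, by simp [IsOutClosed], empty⟩⟩
  obtain ⟨hU, hPU⟩ := (Finset.mem_filter.1 hU).2
  rcases eq_or_ne U Finset.univ with rfl | hne
  · exact hPU
  obtain ⟨C, hC, hUC, hclosed, hconn⟩ := hU.exists_isStronglyConnected hne
  have hle := hmax (U ∪ C) (by simpa using ⟨hclosed, union U C hU hC hUC hconn hPU⟩)
  rw [Finset.card_union_of_disjoint hUC] at hle
  exact absurd hle (by simpa using hC.card_pos.ne')

/-! ### Copies with a given orientation pattern -/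

/-- The orientation pattern of a copy `f` of `F`, as a digraph on the vertices of `F`: the adjacent
pairs that `f` maps to arcs. Copies are counted separately for each pattern. -/
def pattern (arc : V → V → Prop) {F : SimpleGraph W} {H : SimpleGraph V} (f : F.Copy H)
    (w w' : W) : Prop :=
  F.Adj w w' ∧ arc (f w) (f w')

/-- The boundary of `C` in `U`, which is the kernel of the sunflowers formed by extensions of a
fixed placement of `U` to `C`: the vertices of `U` that have a neighbour in `C`. -/
abbrev Boundary (F : SimpleGraph W) (U C : Finset W) : Type _ :=
  {u // u ∈ U ∧ ∃ c ∈ C, F.Adj c u}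

/-- The vertex of `F` that a kernel vertex (on the left) or a petal vertex (on the right) of
`attachment F U C` stands for. -/
def attachmentVal (F : SimpleGraph W) (U C : Finset W) : Boundary F U C ⊕ C → W :=
  Sum.elim Subtype.val Subtype.val

/-- The part of `F` that is added when a placement of `U` is extended to `C`, as a graph whose
sunflowers can be formed: the edges inside `C` or between `U` and `C`, without those inside `U`. -/
def attachment (F : SimpleGraph W) (U C : Finset W) : SimpleGraph (Boundary F U C ⊕ C) where
  Adj x y := F.Adj (attachmentVal F U C x) (attachmentVal F U C y) ∧ (x.isRight ∨ y.isRight)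
  symm := ⟨fun _ _ h => ⟨h.1.symm, h.2.symm⟩⟩
  loopless := ⟨fun _ h => h.1.ne rfl⟩

section Attachment

variable {F : SimpleGraph W} {U C : Finset W} {H : SimpleGraph V}

theorem not_attachment_adj_inl_inl (r r' : Boundary F U C) :
    ¬ (attachment F U C).Adj (.inl r) (.inl r') :=
  fun h => by simpa using h.2

theorem attachmentVal_injective (hUC : Disjoint U C) :
    Function.Injective (attachmentVal F U C) :=
  Subtype.val_injective.sumElim Subtype.val_injective fun r c h =>
    Finset.disjoint_left.1 hUC r.2.1 (h ▸ c.2)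

/-- The restriction of a copy of `F` to the edges inside `C` or between `U` and `C`. -/
def attachmentCopy (hUC : Disjoint U C) (f : F.Copy H) : (attachment F U C).Copy H where
  toHom := ⟨f ∘ attachmentVal F U C, fun h => f.toHom.map_adj h.1⟩
  injective' := f.injective.comp (attachmentVal_injective hUC)

theorem ncard_edgesIn_union_le [Finite W] [DecidableEq W] :
    (edgesIn F (U ∪ C)).ncard ≤ (attachment F U C).edgeSet.ncard + (edgesIn F U).ncard := by
  have hsub : edgesIn F (U ∪ C) ⊆
      Sym2.map (attachmentVal F U C) '' (attachment F U C).edgeSet ∪ edgesIn F U := by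
    have hC : ∀ u v, F.Adj u v → u ∈ U ∪ C → v ∈ C →
        s(u, v) ∈ Sym2.map (attachmentVal F U C) '' (attachment F U C).edgeSet := by
      intro u v huv hu hv
      rcases Finset.mem_union.1 hu with hu | hu
      · exact ⟨s(.inl ⟨u, hu, v, hv, huv.symm⟩, .inr ⟨v, hv⟩), ⟨huv, by simp⟩, rfl⟩
      · exact ⟨s(.inr ⟨u, hu⟩, .inr ⟨v, hv⟩), ⟨huv, by simp⟩, rfl⟩
    rintro e ⟨heF, he⟩
    induction e with | _ u v
    have hu := he u (by simp)
    have hv := he v (by simp)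
    rcases Finset.mem_union.1 hv with hvU | hvC
    · rcases Finset.mem_union.1 hu with huU | huC
      · exact .inr ⟨heF, by simp [huU, hvU]⟩
      · exact .inl (Sym2.eq_swap ▸ hC v u (Adj.symm heF) hv huC)
    · exact .inl (hC u v heF hu hvC)
  calc (edgesIn F (U ∪ C)).ncard
    _ ≤ _ := Set.ncard_le_ncard hsub (Set.toFinite _)
    _ ≤ _ := Set.ncard_union_le _ _
    _ ≤ _ := by
      gcongr
      exact Set.ncard_image_le (Set.toFinite _)

theorem card_boundary_le [Finite W] :
    Nat.card (Boundary F U C) ≤ (attachment F U C).edgeSet.ncard := by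
  choose c hcC hc using fun r : Boundary F U C => r.2.2
  let g : Boundary F U C → (attachment F U C).edgeSet := fun r =>
    ⟨s(.inl r, .inr ⟨c r, hcC r⟩), (hc r).symm, by simp⟩
  have hg : Function.Injective g := fun r r' h => by
    simpa [and_comm] using (Sym2.eq_iff.1 (congrArg Subtype.val h)).resolve_right (by simp) |>.1
  simpa only [Nat.card_coe_set_eq] using Nat.card_le_card_of_injective g hg

theorem IsBalancedOrientation.mul_ncard_attachment_le {a b : ℕ} {arc : V → V → Prop}
    (harc : IsBalancedOrientation H a b arc) (hUC : Disjoint U C) (f : F.Copy H)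
    (hU : IsOutClosed (pattern arc f) U) :
    b * (attachment F U C).edgeSet.ncard ≤ a * C.card := by
  have htail : ∀ x y, (attachment F U C).Adj x y →
      arc (attachmentCopy hUC f x) (attachmentCopy hUC f y) →
        attachmentCopy hUC f x ∈ f '' C := by
    rintro (r | c) (r' | c') hxy harc'
    · exact (not_attachment_adj_inl_inl _ _ hxy).elim
    · exact (Finset.disjoint_left.1 hUC (hU r.2.1 ⟨hxy.1, harc'⟩) c'.2).elim
    all_goals exact ⟨c, c.2, rfl⟩
  have hcard := harc.mul_ncard_le (Sym2.map (attachmentCopy hUC f) '' (attachment F U C).edgeSet)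
    ?_ (f '' C) ?_
  · have hinj : Function.Injective (attachmentCopy hUC f) := (attachmentCopy hUC f).injective
    have hf : Function.Injective f := f.injective
    rwa [Set.ncard_image_of_injective _ (Sym2.map.injective hinj),
      Set.ncard_image_of_injective _ hf, Set.ncard_coe_finset] at hcard
  · rintro _ ⟨e, he, rfl⟩
    induction e with | _ x y
    exact (attachmentCopy hUC f).toHom.map_adj he
  · rintro u v ⟨e, he, huv⟩ harc'
    induction e with | _ x y
    rcases Sym2.eq_iff.1 huv with ⟨rfl, rfl⟩ | ⟨rfl, rfl⟩
    · exact htail x y he harc'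
    · exact htail y x (Adj.symm he) harc'

end Attachment

theorem IsSparse.card_le_of_sunflower {R C ι : Type*} [Finite R] [Finite C] [Nonempty C]
    [Finite ι] {n a : ℕ} {p : ℝ} {H : SimpleGraph V} (hs : IsSparse n p H) (hp : 0 ≤ p)
    (hp1 : p ≤ 1) (ha : n ≤ 2 ^ a) {Q : SimpleGraph (R ⊕ C)}
    (hQ : ∀ r r', ¬ Q.Adj (.inl r) (.inl r')) (f : ι → Q.Copy H)
    (hker : ∀ i j r, f i (.inl r) = f j (.inl r))
    (hdisj : ∀ i j c c', f i (.inr c) = f j (.inr c') → i = j) :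
    (Nat.card ι : ℝ) ≤ 6 * ((n : ℝ) ^ Nat.card C * p ^ Q.edgeSet.ncard) ∨
      Nat.card ι ≤ a * Nat.card R + 1 := by
  rcases isEmpty_or_nonempty ι with _ | _
  · simp
  refine le_of_factorial_le (by positivity) ?_
  calc ((Nat.card ι).factorial : ℝ)
    _ ≤ (Nat.card ι).factorial * (Nat.card (RelAut Q) : ℝ) ^ Nat.card ι :=
      le_mul_of_one_le_right (by positivity)
        (one_le_pow₀ (by exact_mod_cast card_relAut_pos Q))
    _ ≤ _ := hs.factorial_mul_card_relAut_pow_le hp hp1 hQ f hker hdisj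
    _ ≤ 2 * 2 ^ (a * Nat.card R) * _ := by
      rw [pow_mul]
      gcongr
      exact_mod_cast ha

theorem one_le_four_mul_pow_mul_pow {n a b c k : ℕ} (ha : 2 ^ a ≤ 4 * n) (hk : b * k ≤ a * c) :
    1 ≤ 4 ^ c * ((n : ℝ) ^ c * ((2 : ℝ)⁻¹ ^ b) ^ k) := by
  have h : (2 : ℝ) ^ (b * k) ≤ (4 * n) ^ c := by
    calc (2 : ℝ) ^ (b * k)
      _ ≤ 2 ^ (a * c) := by gcongr; exact one_le_two
      _ = (2 ^ a) ^ c := pow_mul ..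
      _ ≤ (4 * n) ^ c := by gcongr; exact_mod_cast ha
  rw [← mul_assoc, ← mul_pow, ← pow_mul, inv_pow, ← div_eq_mul_inv, one_le_div (by positivity)]
  exact h

theorem petal_bound_le_mul {a c k r t : ℕ} {x : ℝ} (ha : 0 < a) (hc : 0 < c) (hr : r ≤ k)
    (hx : 1 ≤ 4 ^ c * x) (ht : (t : ℝ) ≤ 6 * x ∨ t ≤ a * r + 1) :
    (t : ℝ) ≤ x * 2 ^ k * a * (4 * 4 ^ c) := by
  have hx0 : 0 < x := pos_of_mul_pos_right (zero_lt_one.trans_le hx) (by positivity)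
  have ha1 : (1 : ℝ) ≤ a := by exact_mod_cast ha
  rcases ht with ht | ht
  · calc (t : ℝ)
      _ ≤ x * 1 * 1 * (4 * 4 ^ 1) := by linarith
      _ ≤ x * 2 ^ k * a * (4 * 4 ^ c) := by
        gcongr
        · exact one_le_pow₀ one_le_two
        · norm_num
        · exact hc
  · have hrk : (r + 1 : ℝ) ≤ 2 ^ k := by
      exact_mod_cast (Nat.succ_le_succ hr).trans Nat.lt_two_pow_self
    calc (t : ℝ)
      _ ≤ a * r + 1 := by exact_mod_cast ht
      _ ≤ a * (r + 1) := by linarith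
      _ ≤ (4 ^ c * x) * (a * 2 ^ k) := by
        rw [← one_mul ((a : ℝ) * _)]
        gcongr
      _ ≤ 4 * ((4 ^ c * x) * (a * 2 ^ k)) := le_mul_of_one_le_left (by positivity) (by norm_num)
      _ = x * 2 ^ k * a * (4 * 4 ^ c) := by ring

theorem sq_mul_pow_pred_mul_le {a c : ℕ} (hc : 0 < c) :
    (a : ℝ) * (4 * 4 ^ c) * (c * (c * a ^ (c - 1))) ≤ (64 * a) ^ c := by
  have hc2 : (c : ℝ) ≤ 2 ^ c := by exact_mod_cast Nat.lt_two_pow_self.le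
  calc (a : ℝ) * (4 * 4 ^ c) * (c * (c * a ^ (c - 1)))
    _ = 4 * 4 ^ c * (c * c) * (a ^ (c - 1) * a) := by ring
    _ ≤ 4 ^ c * 4 ^ c * (2 ^ c * 2 ^ c) * (a ^ (c - 1) * a) := by
      gcongr
      exact le_self_pow₀ (by norm_num) hc.ne'
    _ = (64 * a) ^ c := by
      rw [← pow_succ, Nat.sub_add_cancel hc, ← mul_pow, ← mul_pow, ← mul_pow, ← mul_pow]
      norm_num

section PatternCount

variable {n a b : ℕ} {H : SimpleGraph V} {arc : V → V → Prop} {F : SimpleGraph W}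
  {D : W → W → Prop} {U C : Finset W} {X : Finset (F.Copy H)}

theorem card_image_pattern_le [Finite W] [DecidableEq (W → W → Prop)] (arc : V → V → Prop)
    (X : Finset (F.Copy H)) : (X.image (pattern arc)).card ≤ 4 ^ F.edgeSet.ncard := by
  classical
  have := Fintype.ofFinite W
  have hdart : Fintype.card (Set F.Dart) = 4 ^ F.edgeSet.ncard := by
    rw [Fintype.card_set, F.dart_card_eq_twice_card_edges, pow_mul, ← coe_edgeFinset,
      Set.ncard_coe_finset]
    rfl
  rw [← hdart, ← Finset.card_univ]
  refine Finset.card_le_card_of_injOn (fun D => {d : F.Dart | D d.fst d.snd})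
    (fun _ _ => Finset.mem_univ _) fun D hD D' hD' hDD' => ?_
  obtain ⟨f, -, rfl⟩ := Finset.mem_image.1 hD
  obtain ⟨g, -, rfl⟩ := Finset.mem_image.1 hD'
  funext w w'
  refine propext (and_congr_right fun hww' => ?_)
  simpa [pattern, hww'] using Set.ext_iff.1 hDD' ⟨(w, w'), hww'⟩

variable [Finite V]

theorem IsBalancedOrientation.card_filter_restrict_le [DecidableEq V]
    (harc : IsBalancedOrientation H a b arc) (hC : IsStronglyConnected D C)
    (hX : ∀ f ∈ X, pattern arc f = D) (c : C) (v : V) :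
    ((X.image fun f : F.Copy H => C.restrict ⇑f).filter fun z => z c = v).card ≤
      a ^ (C.card - 1) := by
  rw [← Fintype.card_coe C]
  refine card_le_pow_of_reachable harc.ncard_arc_le (hC c)
    (fun z hz => (Finset.mem_filter.1 hz).2) fun z hz w w' hww' => ?_
  obtain ⟨f, hf, rfl⟩ := Finset.mem_image.1 (Finset.mem_filter.1 hz).1
  rw [← hX f hf] at hww'
  exact hww'.2

theorem IsSparse.card_le_of_disjoint_restrict [Finite W] [DecidableEq V] {p : ℝ}
    (hs : IsSparse n p H) (hp : 0 ≤ p) (hp1 : p ≤ 1) (ha : n ≤ 2 ^ a) (hC : C.Nonempty)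
    (hUC : Disjoint U C) (hagree : ∀ f ∈ X, ∀ g ∈ X, ∀ u ∈ U, f u = g u)
    {M : Finset (C → V)} (hMX : M ⊆ X.image fun f : F.Copy H => C.restrict ⇑f)
    (hM : ∀ z ∈ M, ∀ z' ∈ M, ∀ c c', z c = z' c' → z = z') :
    (M.card : ℝ) ≤ 6 * ((n : ℝ) ^ C.card * p ^ (attachment F U C).edgeSet.ncard) ∨
      M.card ≤ a * Nat.card (Boundary F U C) + 1 := by
  have : Nonempty C := hC.to_subtype
  choose f hfX hfM using fun z : M => Finset.mem_image.1 (hMX z.2)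
  have hval : ∀ (z : M) (c : C), f z c = z.1 c := fun z => congrFun (hfM z)
  simpa using hs.card_le_of_sunflower hp hp1 ha not_attachment_adj_inl_inl
    (fun z => attachmentCopy hUC (f z))
    (fun z z' r => hagree _ (hfX z) _ (hfX z') r r.2.1)
    (fun z z' c c' h => Subtype.ext (hM _ z.2 _ z'.2 c c' (by rw [← hval, ← hval]; exact h)))

theorem IsSparse.card_image_restrict_le [Finite W] [DecidableEq V]
    (hs : IsSparse n ((2 : ℝ)⁻¹ ^ b) H) (ha : 2 * n ≤ 2 ^ a) (ha' : 2 ^ a ≤ 4 * n)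
    (harc : IsBalancedOrientation H a b arc) (hU : IsOutClosed D U) (hCne : C.Nonempty)
    (hUC : Disjoint U C) (hC : IsStronglyConnected D C) (hX : ∀ f ∈ X, pattern arc f = D)
    (hagree : ∀ f ∈ X, ∀ g ∈ X, ∀ u ∈ U, f u = g u) :
    ((X.image fun f : F.Copy H => C.restrict ⇑f).card : ℝ) ≤
      (2 * (2 : ℝ)⁻¹ ^ b) ^ (attachment F U C).edgeSet.ncard * (64 * a * n) ^ C.card := by
  rcases X.eq_empty_or_nonempty with rfl | ⟨f₀, hf₀⟩
  · simp only [Finset.image_empty, Finset.card_empty, Nat.cast_zero]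
    positivity
  have : Nonempty C := hCne.to_subtype
  have ha0 : 0 < a := Nat.pos_of_ne_zero fun h => by subst h; omega
  set p : ℝ := (2 : ℝ)⁻¹ ^ b
  set k := (attachment F U C).edgeSet.ncard
  obtain ⟨M, hMX, hM, hcard⟩ := exists_disjoint_subfamily
    (X.image fun f : F.Copy H => C.restrict ⇑f) _ (harc.card_filter_restrict_le hC hX)
  rw [Fintype.card_coe] at hcard
  have hpetals := hs.card_le_of_disjoint_restrict (a := a) (by positivity)
    (pow_le_one₀ (by norm_num) (by norm_num)) (by omega) hCne hUC hagree hMX hM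
  have hdens := one_le_four_mul_pow_mul_pow ha'
    (harc.mul_ncard_attachment_le hUC f₀ (by rwa [hX f₀ hf₀]))
  calc ((X.image fun f : F.Copy H => C.restrict ⇑f).card : ℝ)
    _ ≤ M.card * (C.card * (C.card * (a : ℝ) ^ (C.card - 1))) := by exact_mod_cast hcard
    _ ≤ (n ^ C.card * p ^ k) * 2 ^ k * a * (4 * 4 ^ C.card) *
          (C.card * (C.card * (a : ℝ) ^ (C.card - 1))) := by
      gcongr
      exact petal_bound_le_mul ha0 hCne.card_pos card_boundary_le hdens hpetals
    _ = (n ^ C.card * p ^ k) * 2 ^ k *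
          (a * (4 * 4 ^ C.card) * (C.card * (C.card * (a : ℝ) ^ (C.card - 1)))) := by ring
    _ ≤ (n ^ C.card * p ^ k) * 2 ^ k * (64 * a) ^ C.card := by
      gcongr
      exact sq_mul_pow_pred_mul_le hCne.card_pos
    _ = (2 * p) ^ k * (64 * a * n) ^ C.card := by
      rw [mul_pow, mul_pow _ (n : ℝ)]
      ring

theorem IsSparse.card_le_of_pattern_eq [Finite W] (hs : IsSparse n ((2 : ℝ)⁻¹ ^ b) H)
    (ha : 2 * n ≤ 2 ^ a) (ha' : 2 ^ a ≤ 4 * n) (hb : 0 < b)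
    (harc : IsBalancedOrientation H a b arc) (hX : ∀ f ∈ X, pattern arc f = D) :
    (X.card : ℝ) ≤ (2 * (2 : ℝ)⁻¹ ^ b) ^ F.edgeSet.ncard * (64 * a * n) ^ Nat.card W := by
  classical
  have := Fintype.ofFinite W
  set P : ℝ := 2 * (2 : ℝ)⁻¹ ^ b with hP
  have hP1 : P ≤ 1 := by
    have : (2 : ℝ)⁻¹ ^ b ≤ (2 : ℝ)⁻¹ := pow_le_of_le_one (by norm_num) (by norm_num) hb.ne'
    linarith
  suffices h : ((X.image fun f : F.Copy H => Finset.univ.restrict ⇑f).card : ℝ) ≤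
      P ^ (edgesIn F Finset.univ).ncard * (64 * a * n) ^ (Finset.univ : Finset W).card by
    rw [Finset.card_image_of_injective] at h
    · simpa [edgesIn] using h
    · exact fun f g hfg => DFunLike.ext _ _ fun w => congrFun hfg ⟨w, Finset.mem_univ w⟩
  refine isOutClosed_induction D (P := fun U =>
    ((X.image fun f : F.Copy H => U.restrict ⇑f).card : ℝ) ≤
      P ^ (edgesIn F U).ncard * (64 * a * n) ^ U.card) ?_ fun U C hU hCne hUC hC ih => ?_
  · have hempty : edgesIn F ∅ = ∅ := Set.eq_empty_of_forall_notMem fun e he => by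
      induction e with | _ u v
      simpa using he.2 u (by simp)
    simpa [hempty] using Finset.card_le_one.2 fun x _ y _ => Subsingleton.elim x y
  · set T : ℝ := P ^ (attachment F U C).edgeSet.ncard * (64 * a * n) ^ C.card
    have hunion := card_image_restrict_union_le X (fun f : F.Copy H => ⇑f) U C ⌊T⌋₊
      fun f _ => Nat.le_floor <| by
        refine hs.card_image_restrict_le ha ha' harc hU hCne hUC hC
          (fun g hg => hX g (Finset.mem_filter.1 hg).1) fun g hg g' hg' u hu => ?_
        have hgg' := (Finset.mem_filter.1 hg).2.trans (Finset.mem_filter.1 hg').2.symm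
        exact congrFun hgg' ⟨u, hu⟩
    calc ((X.image fun f : F.Copy H => (U ∪ C).restrict ⇑f).card : ℝ)
      _ ≤ ⌊T⌋₊ * (X.image fun f : F.Copy H => U.restrict ⇑f).card := by exact_mod_cast hunion
      _ ≤ T * (P ^ (edgesIn F U).ncard * (64 * a * n) ^ U.card) := by
        gcongr
        exact Nat.floor_le (by positivity)
      _ = P ^ ((attachment F U C).edgeSet.ncard + (edgesIn F U).ncard) *
            (64 * a * n) ^ (U ∪ C).card := by
        rw [Finset.card_union_of_disjoint hUC, pow_add, pow_add]
        ring
      _ ≤ P ^ (edgesIn F (U ∪ C)).ncard * (64 * a * n) ^ (U ∪ C).card := by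
        gcongr ?_ * _
        exact pow_le_pow_of_le_one (by positivity) hP1 ncard_edgesIn_union_le

theorem IsSparse.card_copy_le [Finite W] (hs : IsSparse n ((2 : ℝ)⁻¹ ^ b) H)
    (ha : 2 * n ≤ 2 ^ a) (ha' : 2 ^ a ≤ 4 * n) (hb : 0 < b) (F : SimpleGraph W) :
    (Nat.card (F.Copy H) : ℝ) ≤
      (8 * (2 : ℝ)⁻¹ ^ b) ^ F.edgeSet.ncard * (64 * a * n) ^ Nat.card W := by
  classical
  have := Fintype.ofFinite (F.Copy H)
  obtain ⟨arc, harc⟩ := exists_isBalancedOrientation (hs.mul_ncard_edgesIn_le ha)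
  set T : ℝ := (2 * (2 : ℝ)⁻¹ ^ b) ^ F.edgeSet.ncard * (64 * a * n) ^ Nat.card W
  have hcard := Finset.card_le_mul_card_image (f := pattern arc) (Finset.univ : Finset (F.Copy H))
    ⌊T⌋₊ fun D _ => Nat.le_floor <| hs.card_le_of_pattern_eq ha ha' hb harc (D := D)
      fun f hf => (Finset.mem_filter.1 hf).2
  rw [Finset.card_univ, ← Nat.card_eq_fintype_card] at hcard
  calc (Nat.card (F.Copy H) : ℝ)
    _ ≤ ⌊T⌋₊ * ((Finset.univ : Finset (F.Copy H)).image (pattern arc)).card := by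
      exact_mod_cast hcard
    _ ≤ T * 4 ^ F.edgeSet.ncard := by
      gcongr
      · exact Nat.floor_le (by positivity)
      · exact_mod_cast card_image_pattern_le arc _
    _ = (8 * (2 : ℝ)⁻¹ ^ b) ^ F.edgeSet.ncard * (64 * a * n) ^ Nat.card W := by
      rw [mul_right_comm, ← mul_pow]
      ring_nf

end PatternCount

/-! ### The bound by the squared logarithm -/

theorem factorial_mul_pow_le_pow_mul_descFactorial {n v : ℕ} (h : v ≤ n) :
    v.factorial * n ^ v ≤ v ^ v * n.descFactorial v := by
  have hprod : ∏ i ∈ Finset.range v, ((v - i) * n) ≤ ∏ i ∈ Finset.range v, (v * (n - i)) := by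
    refine Finset.prod_le_prod' fun i _ => ?_
    rw [Nat.sub_mul, Nat.mul_sub, mul_comm v i]
    have := Nat.mul_le_mul_left i h
    omega
  rw [Finset.prod_mul_distrib, Finset.prod_mul_distrib] at hprod
  simpa [← Nat.descFactorial_self, Nat.descFactorial_eq_prod_range] using hprod

theorem pow_le_three_pow_mul_descFactorial {n v : ℕ} (h : v ≤ n) :
    (n : ℝ) ^ v ≤ 3 ^ v * n.descFactorial v := by
  refine le_of_mul_le_mul_left (a := (v.factorial : ℝ)) ?_ (by positivity)
  calc (v.factorial : ℝ) * n ^ v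
    _ ≤ v ^ v * n.descFactorial v := by
      exact_mod_cast factorial_mul_pow_le_pow_mul_descFactorial h
    _ ≤ 3 ^ v * v.factorial * n.descFactorial v := by
      gcongr
      exact pow_self_le_three_pow_mul_factorial v
    _ = v.factorial * (3 ^ v * n.descFactorial v) := by ring

theorem card_le_two_mul_ncard_edgeSet [Finite W] {F : SimpleGraph W} (h : ∀ w, ∃ w', F.Adj w w') :
    Nat.card W ≤ 2 * F.edgeSet.ncard := by
  classical
  have := Fintype.ofFinite W
  choose f hf using h
  rw [← coe_edgeFinset, Set.ncard_coe_finset, ← dart_card_eq_twice_card_edges,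
    Nat.card_eq_fintype_card]
  exact Fintype.card_le_of_injective (fun w => (⟨(w, f w), hf w⟩ : F.Dart))
    fun _ _ hww' => congrArg (fun d : F.Dart => d.fst) hww'

theorem exists_adj_induce_support (J : SimpleGraph W) (w : J.support) :
    ∃ w', (J.induce J.support).Adj w w' := by
  obtain ⟨w', h⟩ := J.mem_support.1 w.2
  exact ⟨⟨w', J.mem_support.2 ⟨_, h.symm⟩⟩, h⟩

theorem ncard_edgeSet_induce_support [Finite W] (J : SimpleGraph W) :
    (J.induce J.support).edgeSet.ncard = J.edgeSet.ncard := by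
  classical
  have := Fintype.ofFinite W
  simpa only [← Set.ncard_coe_finset, coe_edgeFinset] using J.card_edgeFinset_induce_support

theorem card_copy_comp_induce_eq_le [Finite V] [Finite W] (J : SimpleGraph W) (S : Set W)
    {H : SimpleGraph V} (g : (J.induce S).Copy H) :
    Nat.card {f : J.Copy H // f.comp (Copy.induce J S) = g} ≤
      (Nat.card V - Nat.card S).descFactorial (Nat.card W - Nat.card S) := by
  classical
  have := Fintype.ofFinite V
  have := Fintype.ofFinite W
  have hfg (f : {f : J.Copy H // f.comp (Copy.induce J S) = g}) (s : S) : f.1 s = g s :=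
    DFunLike.congr_fun f.2 s
  let restr (f : {f : J.Copy H // f.comp (Copy.induce J S) = g}) :
      {w // w ∉ S} ↪ {v // v ∉ Set.range g} :=
    ⟨fun w => ⟨f.1 w, by
      rintro ⟨s, hs⟩
      exact w.2 (f.1.injective ((hfg f s).trans hs) ▸ s.2)⟩,
    fun w w' h => Subtype.ext (f.1.injective (congrArg Subtype.val h))⟩
  have hrestr : Function.Injective restr := by
    refine fun f f' h => Subtype.ext <| DFunLike.ext _ _ fun w => ?_
    by_cases hw : w ∈ S
    · exact (hfg f ⟨w, hw⟩).trans (hfg f' ⟨w, hw⟩).symm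
    · exact congrArg Subtype.val (DFunLike.congr_fun h ⟨w, hw⟩)
  calc Nat.card {f : J.Copy H // f.comp (Copy.induce J S) = g}
    _ ≤ Nat.card ({w // w ∉ S} ↪ {v // v ∉ Set.range g}) :=
      Nat.card_le_card_of_injective restr hrestr
    _ = _ := by
      simp only [Nat.card_eq_fintype_card, Fintype.card_embedding_eq, Fintype.card_subtype_compl]
      congr 2
      exact Set.card_range_of_injective g.injective

theorem card_copy_le_induce_mul [Finite V] [Finite W] (J : SimpleGraph W) (S : Set W)
    (H : SimpleGraph V) :
    Nat.card (J.Copy H) ≤ Nat.card ((J.induce S).Copy H) *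
      (Nat.card V - Nat.card S).descFactorial (Nat.card W - Nat.card S) := by
  have := Fintype.ofFinite ((J.induce S).Copy H)
  rw [← Nat.card_congr (Equiv.sigmaFiberEquiv fun f : J.Copy H => f.comp (Copy.induce J S)),
    Nat.card_sigma, Nat.card_eq_fintype_card, ← smul_eq_mul]
  exact Finset.sum_le_card_nsmul _ _ _ fun g _ => card_copy_comp_induce_eq_le J S g

theorem card_copy_le_of_induce_support [Finite V] [Finite W] {n : ℕ} {q : ℝ}
    {J : SimpleGraph W} {H : SimpleGraph V} (hV : Nat.card V ≤ n)
    (h : (Nat.card ((J.induce J.support).Copy H) : ℝ) ≤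
      n.descFactorial (Nat.card J.support) * q ^ (J.induce J.support).edgeSet.ncard) :
    (Nat.card (J.Copy H) : ℝ) ≤ n.descFactorial (Nat.card W) * q ^ J.edgeSet.ncard := by
  set s := Nat.card J.support
  calc (Nat.card (J.Copy H) : ℝ)
    _ ≤ Nat.card ((J.induce J.support).Copy H) * (n - s).descFactorial (Nat.card W - s) := by
      exact_mod_cast (card_copy_le_induce_mul J J.support H).trans
        (Nat.mul_le_mul_left _ (Nat.descFactorial_le _ (by omega)))
    _ ≤ (n.descFactorial s * q ^ J.edgeSet.ncard) * (n - s).descFactorial (Nat.card W - s) := by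
      rw [← ncard_edgeSet_induce_support]
      gcongr
    _ = n.descFactorial (Nat.card W) * q ^ J.edgeSet.ncard := by
      rw [← Nat.descFactorial_mul_descFactorial (Finite.card_subtype_le _ : s ≤ Nat.card W)]
      push_cast
      ring

theorem card_copy_eq_zero_or_card_le [Finite V] (F : SimpleGraph W) (H : SimpleGraph V) :
    Nat.card (F.Copy H) = 0 ∨ Nat.card W ≤ Nat.card V := by
  rcases isEmpty_or_nonempty (F.Copy H) with _ | ⟨⟨f⟩⟩
  · exact .inl Nat.card_of_isEmpty
  · exact .inr (Nat.card_le_card_of_injective f f.injective)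

theorem card_copy_le_descFactorial_mul [Finite V] [Finite W] {n : ℕ} {A B : ℝ}
    {F : SimpleGraph W} {H : SimpleGraph V} (hV : Nat.card V ≤ n) (hA : 0 ≤ A) (hB : 1 ≤ B)
    (h : (Nat.card ((F.induce F.support).Copy H) : ℝ) ≤
      A ^ (F.induce F.support).edgeSet.ncard * (B * n) ^ Nat.card F.support) :
    (Nat.card (F.Copy H) : ℝ) ≤
      n.descFactorial (Nat.card W) * (9 * A * B ^ 2) ^ F.edgeSet.ncard := by
  refine card_copy_le_of_induce_support hV ?_
  have hv := card_le_two_mul_ncard_edgeSet (exists_adj_induce_support F)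
  generalize F.induce F.support = F' at *
  rcases card_copy_eq_zero_or_card_le F' H with h0 | hvn
  · rw [h0, Nat.cast_zero]
    positivity
  set v := Nat.card F.support
  set e := F'.edgeSet.ncard
  calc (Nat.card (F'.Copy H) : ℝ)
    _ ≤ A ^ e * (B * n) ^ v := h
    _ = A ^ e * B ^ v * n ^ v := by rw [mul_pow, mul_assoc]
    _ ≤ A ^ e * B ^ v * (3 ^ v * n.descFactorial v) := by
      gcongr
      exact pow_le_three_pow_mul_descFactorial (hvn.trans hV)
    _ = n.descFactorial v * (A ^ e * (B * 3) ^ v) := by rw [mul_pow]; ring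
    _ ≤ n.descFactorial v * (A ^ e * (B * 3) ^ (2 * e)) := by
      gcongr
      linarith
    _ = n.descFactorial v * (9 * A * B ^ 2) ^ e := by
      rw [pow_mul, ← mul_pow]
      ring_nf

theorem IsSparse.card_copy_le_descFactorial [Finite V] [Finite W] {n a b : ℕ} {H : SimpleGraph V}
    (hs : IsSparse n ((2 : ℝ)⁻¹ ^ b) H) (ha : 2 * n ≤ 2 ^ a) (ha' : 2 ^ a ≤ 4 * n) (hb : 0 < b)
    (hV : Nat.card V ≤ n) (F : SimpleGraph W) :
    (Nat.card (F.Copy H) : ℝ) ≤ n.descFactorial (Nat.card W) *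
      (294912 * a ^ 2 * (2 : ℝ)⁻¹ ^ b) ^ F.edgeSet.ncard := by
  have ha1 : (1 : ℝ) ≤ a := by
    exact_mod_cast Nat.one_le_iff_ne_zero.2 fun h => by subst h; omega
  convert card_copy_le_descFactorial_mul hV (by positivity) (by linarith : 1 ≤ 64 * (a : ℝ))
    (hs.card_copy_le ha ha' hb (F.induce F.support)) using 3
  ring

theorem one_lt_card_of_ne_bot [Finite V] {H : SimpleGraph V} (hH : H ≠ ⊥) : 1 < Nat.card V := by
  by_contra! h
  have := Finite.card_le_one_iff_subsingleton.1 h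
  exact hH (Subsingleton.elim _ _)

theorem graphicThreshold_pos [Fintype V] {n : ℕ} {H : SimpleGraph V} (hH : H ≠ ⊥)
    (hn : Fintype.card V ≤ n) : 0 < (graphicThreshold n H : ℝ) := by
  have hs := isSparse_of_mem_graphicFeasible (isLeast_graphicThreshold n H hn).1
  refine (graphicThreshold n H).2.1.lt_of_ne fun h => ?_
  have hedges : H.edgeSet.ncard ≠ 0 :=
    ((Set.ncard_pos (Set.toFinite _)).2 (edgeSet_nonempty.2 hH)).ne'
  have := hs.one_le (graphicThreshold n H).2.1 (Copy.id H)
  rw [← h, zero_pow hedges] at this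
  norm_num at this

theorem fractionalThreshold_le_of_card_copy_le [Fintype V] {n : ℕ} {q : ℝ} {H : SimpleGraph V}
    (hq : 0 ≤ q) (h : ∀ J : H.Subgraph, (Nat.card (J.coe.Copy H) : ℝ) ≤
      n.descFactorial (Nat.card J.verts) * q ^ J.coe.edgeSet.ncard) :
    (fractionalThreshold n H : ℝ) ≤ q := by
  rcases le_total 1 q with h1 | h1
  · exact (fractionalThreshold n H).2.2.trans h1
  · have hle : fractionalThreshold n H ≤ ⟨q, hq, h1⟩ :=
      sInf_le (mem_fractionalFeasible_of_card_copy_le h)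
    exact hle

theorem exists_two_pow_mem_Icc {n : ℕ} (hn : 2 ≤ n) : ∃ a, 2 * n ≤ 2 ^ a ∧ 2 ^ a ≤ 4 * n := by
  refine ⟨Nat.log 2 n + 2, ?_, ?_⟩ <;> rw [pow_add]
  · have := Nat.lt_pow_succ_log_self one_lt_two n
    rw [pow_succ] at this
    omega
  · have := Nat.pow_log_le_self 2 (x := n) (by omega)
    omega

theorem le_three_mul_logb {n a : ℕ} (hn : 2 ≤ n) (ha : 2 ^ a ≤ 4 * n) :
    (a : ℝ) ≤ 3 * Real.logb 2 n := by
  have ha' : 2 ^ a ≤ n ^ 3 := ha.trans (by nlinarith [Nat.mul_le_mul hn hn])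
  calc (a : ℝ)
    _ = Real.logb 2 (2 ^ a) := by rw [Real.logb_pow]; simp
    _ ≤ Real.logb 2 (n ^ 3) := Real.logb_le_logb_of_le one_lt_two (by positivity)
      (by exact_mod_cast ha')
    _ = 3 * Real.logb 2 n := by rw [Real.logb_pow]; norm_num

theorem one_le_logb_two {x : ℝ} (hx : 2 ≤ x) : 1 ≤ Real.logb 2 x := by
  rw [Real.le_logb_iff_rpow_le one_lt_two (by linarith)]
  simpa using hx

theorem fractionalThreshold_lt_mul_log_sq [Fintype V] (n : ℕ) (H : SimpleGraph V)
    (hn : Fintype.card V ≤ n) (hH : H ≠ ⊥) :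
    (fractionalThreshold n H : ℝ) <
      5308416 * (graphicThreshold n H : ℝ) * (Real.logb 2 n) ^ 2 := by
  have hn2 : 2 ≤ n := by
    have := one_lt_card_of_ne_bot hH
    rw [Nat.card_eq_fintype_card] at this
    omega
  have hp0 := graphicThreshold_pos hH hn
  have hs := isSparse_of_mem_graphicFeasible (isLeast_graphicThreshold n H hn).1
  set p : ℝ := (graphicThreshold n H : ℝ)
  set L := Real.logb 2 n
  have hL : 1 ≤ L := one_le_logb_two (by exact_mod_cast hn2)
  rcases lt_or_ge 2⁻¹ p with hp | hp
  · have := (fractionalThreshold n H).2.2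
    nlinarith [one_le_pow₀ hL (n := 2)]
  obtain ⟨b, hbp, hpb⟩ := exists_nat_pow_near_of_lt_one hp0 (by linarith : p ≤ 1)
    (by norm_num : (0 : ℝ) < 2⁻¹) (by norm_num)
  have hb : 0 < b := Nat.pos_of_ne_zero fun h => by
    rw [h, zero_add, pow_one] at hbp
    linarith
  have hb2 : (2 : ℝ)⁻¹ ^ b < 2 * p := by
    rw [pow_succ] at hbp
    linarith
  obtain ⟨a, ha, ha'⟩ := exists_two_pow_mem_Icc hn2
  calc (fractionalThreshold n H : ℝ)
    _ ≤ 294912 * a ^ 2 * (2 : ℝ)⁻¹ ^ b :=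
      fractionalThreshold_le_of_card_copy_le (by positivity) fun J =>
        (hs.mono hp0.le hpb).card_copy_le_descFactorial ha ha' hb
          (by rwa [Nat.card_eq_fintype_card]) J.coe
    _ ≤ 294912 * (3 * L) ^ 2 * (2 : ℝ)⁻¹ ^ b := by
      gcongr
      exact le_three_mul_logb hn2 ha'
    _ < 294912 * (3 * L) ^ 2 * (2 * p) := by gcongr
    _ = 5308416 * p * L ^ 2 := by ring

/-! ### Thresholds below `1 / (3 n)` -/

theorem ncard_edgeSet_add_one_of_isTree [Finite V] {L : SimpleGraph V} (hL : L.IsTree) :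
    L.edgeSet.ncard + 1 = Nat.card V :=
  (isTree_iff_connected_and_card.1 hL).2

theorem IsSparse.isTree_of_connected [Finite W] {n : ℕ} {p : ℝ} {H : SimpleGraph V}
    (hs : IsSparse n p H) (hp : 0 ≤ p) (hp1 : p ≤ 1) (hnp : n * p ≤ 1 / 3) {P : SimpleGraph W}
    (hP : P.Connected) (f : P.Copy H) : P.IsTree := by
  refine isTree_iff_connected_and_card.2 ⟨hP, hP.card_vert_le_card_edgeSet_add_one.antisymm' ?_⟩
  rw [Nat.card_coe_set_eq]
  by_contra! hcycle
  have := hP.nonempty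
  set v := Nat.card W
  have hmany : 1 ≤ 2 * (n ^ v * p ^ P.edgeSet.ncard) := hs.one_le hp f
  have hfew : n ^ v * p ^ P.edgeSet.ncard ≤ 1 / 3 :=
    calc n ^ v * p ^ P.edgeSet.ncard
      _ ≤ n ^ v * p ^ v := by
        gcongr ?_ * ?_
        exact pow_le_pow_of_le_one hp hp1 (by omega)
      _ = (n * p) ^ v := (mul_pow ..).symm
      _ ≤ n * p := pow_le_of_le_one (by positivity) (by linarith) Nat.card_pos.ne'
      _ ≤ 1 / 3 := hnp
  linarith

/-- The inclusion of a connected component of `H`, as a copy of it in `H`. -/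
def componentCopy {H : SimpleGraph V} (c : H.ConnectedComponent) : c.toSimpleGraph.Copy H :=
  ⟨c.toSimpleGraph_hom, Subtype.val_injective⟩

theorem mul_le_of_factorial_mul_pow_le {m : ℕ} {A x : ℝ} (hA : 0 ≤ A) (hx : 0 ≤ x)
    (h : m.factorial * A ^ m ≤ 2 * x ^ m) : m * A ≤ 6 * x := by
  rcases Nat.eq_zero_or_pos m with rfl | hm
  · simpa using hx
  refine (pow_le_pow_iff_left₀ (by positivity) (by positivity) hm.ne').1 ?_
  calc (m * A) ^ m
    _ = (m : ℝ) ^ m * A ^ m := mul_pow ..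
    _ ≤ 3 ^ m * m.factorial * A ^ m := by
      gcongr
      exact pow_self_le_three_pow_mul_factorial m
    _ = 3 ^ m * (m.factorial * A ^ m) := mul_assoc ..
    _ ≤ 3 ^ m * (2 * x ^ m) := mul_le_mul_of_nonneg_left h (by positivity)
    _ ≤ 3 ^ m * (2 ^ m * x ^ m) := by
      gcongr
      exact le_self_pow₀ one_le_two hm.ne'
    _ = (6 * x) ^ m := by
      rw [← mul_pow, ← mul_pow]
      ring_nf

theorem IsSparse.sum_card_component_iso_le [Finite W] [Nonempty W] {n : ℕ}
    {p : ℝ} {H : SimpleGraph V} [Fintype H.ConnectedComponent] (hs : IsSparse n p H)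
    (hp : 0 ≤ p) (hp1 : p ≤ 1) (L : SimpleGraph W) :
    ∑ c : H.ConnectedComponent, (Nat.card (c.toSimpleGraph ≃g L) : ℝ) ≤
      6 * (n ^ Nat.card W * p ^ L.edgeSet.ncard) := by
  classical
  have hsum : ∑ c : H.ConnectedComponent, Nat.card (c.toSimpleGraph ≃g L) =
      Nat.card {c : H.ConnectedComponent // Nonempty (c.toSimpleGraph ≃g L)} *
        Nat.card (L ≃g L) := by
    rw [Nat.card_eq_fintype_card (α := Subtype _), Fintype.card_subtype, ← smul_eq_mul,
      ← Finset.sum_const, Finset.sum_filter]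
    refine Finset.sum_congr rfl fun c _ => ?_
    split_ifs with h
    · rw [card_iso_eq_card_aut h.some, card_aut_congr h.some]
    · have := not_nonempty_iff.1 h
      exact Nat.card_of_isEmpty
  have hfact := hs.factorial_mul_card_aut_pow_le hp hp1
    (fun c : {c : H.ConnectedComponent // Nonempty (c.toSimpleGraph ≃g L)} =>
      (componentCopy c.1).comp c.2.some.symm.toCopy) fun c c' w w' h => Subtype.ext <| by
        rw [← (c.2.some.symm w).2, ← (c'.2.some.symm w').2]
        exact congrArg H.connectedComponentMk h
  rw [← Nat.cast_sum, hsum, Nat.cast_mul]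
  exact mul_le_of_factorial_mul_pow_le (by positivity) (by positivity) hfact

theorem exists_adj_dist_lt {L : SimpleGraph V} (hL : L.Connected) {x r : V} (hxr : x ≠ r) :
    ∃ y, L.Adj x y ∧ L.dist y r < L.dist x r := by
  obtain ⟨w, hw⟩ := hL.exists_walk_length_eq_dist x r
  cases w with
  | nil => exact (hxr rfl).elim
  | cons hxy q => exact ⟨_, hxy, hw ▸ Nat.lt_succ_of_le (dist_le q)⟩

theorem injective_mk_of_lt {S : Set V} {d : V → ℕ} {parent : S → V}
    (h : ∀ x : S, d (parent x) < d x) :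
    Function.Injective fun x : S => s(x.1, parent x) := fun x y hxy => by
  rcases Sym2.eq_iff.1 hxy with ⟨hxy, -⟩ | ⟨hxp, hpx⟩
  · exact Subtype.ext hxy
  · have hx := h x
    have hy := h y
    rw [hpx] at hx
    rw [← hxp] at hy
    omega

theorem edgeSet_eq_union_range_parent [Finite V] [Finite W] {F : SimpleGraph W}
    (hF : F.Connected) {L : SimpleGraph V} (hL : L.IsTree) {f : W ↪ V} (hf : F.map f ≤ L)
    {d : V → ℕ} {parent : ((Set.range f)ᶜ : Set V) → V}
    (hparent : ∀ x : ((Set.range f)ᶜ : Set V), L.Adj x (parent x) ∧ d (parent x) < d x) :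
    L.edgeSet = (F.map f).edgeSet ∪ Set.range fun x => s(x.1, parent x) := by
  symm
  refine Set.eq_of_subset_of_ncard_le (Set.union_subset (edgeSet_mono hf) ?_) ?_ (Set.toFinite _)
  · rintro _ ⟨x, rfl⟩
    exact (hparent x).1
  have hdisj : Disjoint (F.map f).edgeSet (Set.range fun x => s(x.1, parent x)) := by
    rw [Set.disjoint_left]
    rintro _ he ⟨x, rfl⟩
    obtain ⟨w, -, -, hw, -⟩ := (map_adj ..).1 he
    exact x.2 ⟨w, hw⟩
  have hFe : Nat.card W ≤ F.edgeSet.ncard + 1 := hF.card_vert_le_card_edgeSet_add_one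
  have hLe := ncard_edgeSet_add_one_of_isTree hL
  have hcompl := Set.ncard_add_ncard_compl (Set.range f)
  have hrange : (Set.range f).ncard = Nat.card W := Set.ncard_range_of_injective f.injective
  rw [Set.ncard_union_eq hdisj (Set.toFinite _) (Set.toFinite _), ncard_edgeSet_map,
    Set.ncard_range_of_injective (injective_mk_of_lt fun x => (hparent x).2), Nat.card_coe_set_eq]
  omega

theorem card_tree_map_le [Finite V] [Finite W] {F : SimpleGraph W} (hF : F.Connected)
    (f : W ↪ V) :
    Nat.card {L : SimpleGraph V // L.IsTree ∧ F.map f ≤ L} ≤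
      Nat.card V ^ (Nat.card V - Nat.card W) := by
  obtain ⟨w⟩ := hF.nonempty
  -- Root `L` at `f w`: since `L` is a tree, its edges are those of `F.map f` and the edges from
  -- the vertices outside the range of `f` to their parents.
  have hnext (L : {L : SimpleGraph V // L.IsTree ∧ F.map f ≤ L})
      (x : ((Set.range f)ᶜ : Set V)) : ∃ y, L.1.Adj x y ∧ L.1.dist y (f w) < L.1.dist x (f w) :=
    exists_adj_dist_lt L.2.1.connected fun h => x.2 ⟨w, h.symm⟩
  choose parent hparent using hnext
  have hedges (L : {L : SimpleGraph V // L.IsTree ∧ F.map f ≤ L}) :=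
    edgeSet_eq_union_range_parent hF L.2.1 L.2.2 (d := fun x => L.1.dist x (f w)) (hparent L)
  have hinj : Function.Injective parent := fun L L' h =>
    Subtype.ext <| edgeSet_injective <| by rw [hedges, hedges, h]
  have hcard : Nat.card ((Set.range f)ᶜ : Set V) = Nat.card V - Nat.card W := by
    rw [Nat.card_coe_set_eq, Set.ncard_compl, Set.ncard_range_of_injective f.injective]
  simpa only [Nat.card_fun, hcard] using Nat.card_le_card_of_injective parent hinj

theorem card_sigma_tree_copy_le [Finite V] [Finite W] {F : SimpleGraph W} (hF : F.Connected) :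
    Nat.card (Σ L : {L : SimpleGraph V // L.IsTree}, F.Copy L.1) ≤
      (Nat.card V).descFactorial (Nat.card W) * Nat.card V ^ (Nat.card V - Nat.card W) := by
  classical
  have := Fintype.ofFinite V
  have := Fintype.ofFinite W
  let swap : (Σ L : {L : SimpleGraph V // L.IsTree}, {f : W ↪ V // F.map f ≤ L.1}) ≃
      Σ f : W ↪ V, {L : SimpleGraph V // L.IsTree ∧ F.map f ≤ L} :=
    { toFun := fun x => ⟨x.2.1, x.1.1, x.1.2, x.2.2⟩
      invFun := fun x => ⟨⟨x.2.1, x.2.2.1⟩, x.1, x.2.2.2⟩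
      left_inv := fun _ => rfl
      right_inv := fun _ => rfl }
  calc Nat.card (Σ L : {L : SimpleGraph V // L.IsTree}, F.Copy L.1)
    _ = Nat.card (Σ f : W ↪ V, {L : SimpleGraph V // L.IsTree ∧ F.map f ≤ L}) := by
      rw [← Nat.card_congr swap, Nat.card_sigma, Nat.card_sigma]
      exact Finset.sum_congr rfl fun L _ => card_copy_eq_card_map_le F L.1
    _ ≤ Nat.card (W ↪ V) * Nat.card V ^ (Nat.card V - Nat.card W) := by
      rw [Nat.card_sigma, Nat.card_eq_fintype_card (α := W ↪ V), ← smul_eq_mul]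
      exact Finset.sum_le_card_nsmul _ _ _ fun f _ => card_tree_map_le hF f
    _ = _ := by simp only [Nat.card_eq_fintype_card, Fintype.card_embedding_eq]

theorem card_copy_congr {F : SimpleGraph W} {U : Type*} {G : SimpleGraph U} {G' : SimpleGraph V}
    (e : G ≃g G') : Nat.card (F.Copy G) = Nat.card (F.Copy G') :=
  Nat.card_congr
    { toFun := fun f => e.toCopy.comp f
      invFun := fun f => e.symm.toCopy.comp f
      left_inv := fun f => by ext; simp
      right_inv := fun f => by ext; simp }

theorem factorial_mul_card_copy_le_sum_tree {C D : Type*} [Finite D]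
    [Fintype {L : SimpleGraph D // L.IsTree}] (F : SimpleGraph W) {G : SimpleGraph C}
    (hG : G.IsTree) (e : C ≃ D) :
    (Nat.card C).factorial * Nat.card (F.Copy G) ≤
      ∑ L : {L : SimpleGraph D // L.IsTree}, Nat.card (G ≃g L.1) * Nat.card (F.Copy L.1) := by
  have := Finite.of_equiv D e.symm
  have htree (π : C ≃ D) : (G.map π.toEmbedding).IsTree := (Iso.map π G).isTree_iff.1 hG
  let g (π : C ≃ D) : Σ L : {L : SimpleGraph D // L.IsTree}, G ≃g L.1 :=
    ⟨⟨G.map π.toEmbedding, htree π⟩, Iso.map π G⟩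
  have hg : Function.Injective g := fun π π' h => congrArg (fun x => x.2.toEquiv) h
  calc (Nat.card C).factorial * Nat.card (F.Copy G)
    _ = Nat.card (C ≃ D) * Nat.card (F.Copy G) := by
      rw [← Nat.card_perm, Nat.card_congr ((Equiv.refl C).equivCongr e)]
    _ ≤ (∑ L : {L : SimpleGraph D // L.IsTree}, Nat.card (G ≃g L.1)) * Nat.card (F.Copy G) := by
      rw [← Nat.card_sigma]
      exact Nat.mul_le_mul_right _ (Nat.card_le_card_of_injective g hg)
    _ = ∑ L : {L : SimpleGraph D // L.IsTree}, Nat.card (G ≃g L.1) * Nat.card (F.Copy L.1) := by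
      rw [Finset.sum_mul]
      refine Finset.sum_congr rfl fun L _ => ?_
      rcases isEmpty_or_nonempty (G ≃g L.1) with _ | ⟨⟨e⟩⟩
      · simp only [Nat.card_of_isEmpty, zero_mul]
      · rw [card_copy_congr e]

theorem IsSparse.factorial_mul_sum_card_copy_component_le [Finite V] [Finite W] {n : ℕ}
    {p : ℝ} {H : SimpleGraph V} [Fintype H.ConnectedComponent] (hs : IsSparse n p H)
    (hp : 0 ≤ p) (hp1 : p ≤ 1) (hnp : n * p ≤ 1 / 3) {F : SimpleGraph W} (hF : F.Connected)
    (v : ℕ) :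
    ((v + 1).factorial : ℝ) *
        ∑ c ∈ {c : H.ConnectedComponent | Nat.card c = v + 1},
          (Nat.card (F.Copy c.toSimpleGraph) : ℝ) ≤
      6 * (n ^ (v + 1) * p ^ v) *
        ((v + 1).descFactorial (Nat.card W) * (v + 1 : ℕ) ^ (v + 1 - Nat.card W)) := by
  classical
  let Tree := {L : SimpleGraph (Fin (v + 1)) // L.IsTree}
  have hrelabel (c : H.ConnectedComponent) (hc : Nat.card c = v + 1) :
      ((v + 1).factorial : ℝ) * Nat.card (F.Copy c.toSimpleGraph) ≤
        ∑ L : Tree, (Nat.card (c.toSimpleGraph ≃g L.1) : ℝ) * Nat.card (F.Copy L.1) := by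
    have h := factorial_mul_card_copy_le_sum_tree F
      (hs.isTree_of_connected hp hp1 hnp c.connected_toSimpleGraph (componentCopy c))
      (Finite.equivFinOfCardEq hc)
    rw [hc] at h
    exact_mod_cast h
  calc ((v + 1).factorial : ℝ) *
        ∑ c ∈ {c : H.ConnectedComponent | Nat.card c = v + 1},
          (Nat.card (F.Copy c.toSimpleGraph) : ℝ)
    _ ≤ ∑ c ∈ {c : H.ConnectedComponent | Nat.card c = v + 1},
          ∑ L : Tree, (Nat.card (c.toSimpleGraph ≃g L.1) : ℝ) * Nat.card (F.Copy L.1) := by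
      rw [Finset.mul_sum]
      exact Finset.sum_le_sum fun c hc => hrelabel c (Finset.mem_filter.1 hc).2
    _ ≤ ∑ c : H.ConnectedComponent,
          ∑ L : Tree, (Nat.card (c.toSimpleGraph ≃g L.1) : ℝ) * Nat.card (F.Copy L.1) :=
      Finset.sum_le_sum_of_subset_of_nonneg (Finset.filter_subset _ _) fun _ _ _ => by positivity
    _ = ∑ L : Tree, (∑ c : H.ConnectedComponent, (Nat.card (c.toSimpleGraph ≃g L.1) : ℝ)) *
          Nat.card (F.Copy L.1) := by
      rw [Finset.sum_comm]
      simp only [Finset.sum_mul]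
    _ ≤ ∑ L : Tree, 6 * (n ^ (v + 1) * p ^ v) * (Nat.card (F.Copy L.1) : ℝ) := by
      gcongr with L
      have hedges := ncard_edgeSet_add_one_of_isTree L.2
      rw [Nat.card_fin, Nat.add_right_cancel_iff] at hedges
      simpa only [hedges, Nat.card_fin] using hs.sum_card_component_iso_le hp hp1 L.1
    _ = 6 * (n ^ (v + 1) * p ^ v) * Nat.card (Σ L : Tree, F.Copy L.1) := by
      rw [← Finset.mul_sum, Nat.card_sigma, Nat.cast_sum]
    _ ≤ _ := by
      gcongr
      have h := card_sigma_tree_copy_le (V := Fin (v + 1)) hF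
      rw [Nat.card_fin] at h
      exact_mod_cast h

theorem descFactorial_mul_pow_le {w k : ℕ} (h : w ≤ k) :
    (k.descFactorial w * k ^ (k - w) : ℝ) ≤ k.factorial * Real.exp 1 ^ k := by
  have hexp := Real.pow_div_factorial_le_exp (k : ℝ) (by positivity) (k - w)
  rw [div_le_iff₀ (by positivity), ← Real.exp_one_pow] at hexp
  calc (k.descFactorial w * k ^ (k - w) : ℝ)
    _ ≤ k.descFactorial w * (Real.exp 1 ^ k * (k - w).factorial) := by gcongr
    _ = ((k - w).factorial * k.descFactorial w : ℕ) * Real.exp 1 ^ k := by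
      push_cast
      ring
    _ = k.factorial * Real.exp 1 ^ k := by rw [Nat.factorial_mul_descFactorial h]

theorem IsSparse.sum_card_copy_component_le [Finite V] [Finite W] {n : ℕ} {p : ℝ}
    {H : SimpleGraph V} [Fintype H.ConnectedComponent] (hs : IsSparse n p H) (hp : 0 ≤ p)
    (hp1 : p ≤ 1) (hnp : n * p ≤ 1 / 3) {F : SimpleGraph W} (hF : F.Connected) {v : ℕ}
    (hv : Nat.card W ≤ v + 1) :
    ∑ c ∈ {c : H.ConnectedComponent | Nat.card c = v + 1},
        (Nat.card (F.Copy c.toSimpleGraph) : ℝ) ≤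
      6 * Real.exp 1 * n * (Real.exp 1 * (n * p)) ^ v := by
  refine le_of_mul_le_mul_left (a := ((v + 1).factorial : ℝ)) ?_ (by positivity)
  calc ((v + 1).factorial : ℝ) *
        ∑ c ∈ {c : H.ConnectedComponent | Nat.card c = v + 1},
          (Nat.card (F.Copy c.toSimpleGraph) : ℝ)
    _ ≤ 6 * (n ^ (v + 1) * p ^ v) *
          ((v + 1).descFactorial (Nat.card W) * (v + 1 : ℕ) ^ (v + 1 - Nat.card W)) :=
      hs.factorial_mul_sum_card_copy_component_le hp hp1 hnp hF v
    _ ≤ 6 * (n ^ (v + 1) * p ^ v) * ((v + 1).factorial * Real.exp 1 ^ (v + 1)) := by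
      gcongr 6 * (n ^ (v + 1) * p ^ v) * ?_
      exact descFactorial_mul_pow_le hv
    _ = (v + 1).factorial * (6 * Real.exp 1 * n * (Real.exp 1 * (n * p)) ^ v) := by
      rw [mul_pow, mul_pow, pow_succ, pow_succ]
      ring

theorem card_copy_le_sum_component [Finite V] [Finite W] {F : SimpleGraph W} (hF : F.Connected)
    (H : SimpleGraph V) [Fintype H.ConnectedComponent] :
    Nat.card (F.Copy H) ≤ ∑ c : H.ConnectedComponent, Nat.card (F.Copy c.toSimpleGraph) := by
  obtain ⟨w₀⟩ := hF.nonempty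
  have hmem (f : F.Copy H) (w : W) : H.connectedComponentMk (f w) = H.connectedComponentMk (f w₀) :=
    ConnectedComponent.sound ((hF.preconnected w w₀).map f.toHom)
  let g (f : F.Copy H) : Σ c : H.ConnectedComponent, F.Copy c.toSimpleGraph :=
    ⟨H.connectedComponentMk (f w₀), ⟨fun w => ⟨f w, hmem f w⟩, f.toHom.map_adj⟩,
      fun _ _ h => f.injective (congrArg Subtype.val h)⟩
  have hg : Function.Injective g := fun f f' h =>
    DFunLike.coe_injective (congrArg (fun x => fun w => (x.2 w : V)) h)
  rw [← Nat.card_sigma]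
  exact Nat.card_le_card_of_injective g hg

theorem IsSparse.card_copy_le_geom_sum [Finite V] [Finite W] {n : ℕ} {p : ℝ} {H : SimpleGraph V}
    (hs : IsSparse n p H) (hp : 0 ≤ p) (hp1 : p ≤ 1) (hnp : n * p ≤ 1 / 3) {F : SimpleGraph W}
    (hF : F.Connected) {e : ℕ} (he : Nat.card W = e + 1) :
    (Nat.card (F.Copy H) : ℝ) ≤
      6 * Real.exp 1 * n * ∑ v ∈ Finset.Ico e (Nat.card V), (Real.exp 1 * (n * p)) ^ v := by
  classical
  have := Fintype.ofFinite V
  have := Fintype.ofFinite H.ConnectedComponent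
  have hsmall (c : H.ConnectedComponent) (hc : Nat.card c ∉ Finset.Ico (e + 1) (Nat.card V + 1)) :
      (Nat.card (F.Copy c.toSimpleGraph) : ℝ) = 0 := by
    have hcV : Nat.card c ≤ Nat.card V := Finite.card_subtype_le _
    rw [Finset.mem_Ico] at hc
    exact_mod_cast (card_copy_eq_zero_or_card_le F c.toSimpleGraph).resolve_right (by omega)
  calc (Nat.card (F.Copy H) : ℝ)
    _ ≤ ∑ c : H.ConnectedComponent, (Nat.card (F.Copy c.toSimpleGraph) : ℝ) := by
      exact_mod_cast card_copy_le_sum_component hF H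
    _ = ∑ c ∈ {c : H.ConnectedComponent | Nat.card c ∈ Finset.Ico (e + 1) (Nat.card V + 1)},
          (Nat.card (F.Copy c.toSimpleGraph) : ℝ) :=
      (Finset.sum_filter_of_ne fun c _ h => not_not.1 fun hc => h (hsmall c hc)).symm
    _ = ∑ v ∈ Finset.Ico e (Nat.card V), ∑ c ∈ {c : H.ConnectedComponent | Nat.card c = v + 1},
          (Nat.card (F.Copy c.toSimpleGraph) : ℝ) := by
      rw [Finset.sum_Ico_add' (fun k => ∑ c ∈ {c : H.ConnectedComponent | Nat.card c = k},
        (Nat.card (F.Copy c.toSimpleGraph) : ℝ))]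
      exact (Finset.sum_fiberwise_eq_sum_filter _ _ _ _).symm
    _ ≤ ∑ v ∈ Finset.Ico e (Nat.card V), 6 * Real.exp 1 * n * (Real.exp 1 * (n * p)) ^ v :=
      Finset.sum_le_sum fun v hv => hs.sum_card_copy_component_le hp hp1 hnp hF
        (he.trans_le (Nat.succ_le_succ (Finset.mem_Ico.1 hv).1))
    _ = _ := (Finset.mul_sum ..).symm

theorem IsSparse.card_copy_le_of_connected [Finite V] [Finite W] {n : ℕ} {p : ℝ}
    {H : SimpleGraph V} (hs : IsSparse n p H) (hp : 0 ≤ p) (hp1 : p ≤ 1) (hnp : n * p ≤ 1 / 3)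
    {F : SimpleGraph W} (hF : F.Connected) (hFe : F.edgeSet.ncard ≠ 0) :
    (Nat.card (F.Copy H) : ℝ) ≤ (540 * p) ^ F.edgeSet.ncard * n ^ Nat.card W := by
  rcases isEmpty_or_nonempty (F.Copy H) with _ | ⟨⟨f⟩⟩
  · rw [Nat.card_of_isEmpty, Nat.cast_zero]
    positivity
  have hcard := (ncard_edgeSet_add_one_of_isTree
    (hs.isTree_of_connected hp hp1 hnp hF f)).symm
  rw [hcard]
  set e := F.edgeSet.ncard
  have hexp := Real.exp_one_lt_d9
  have hr0 : 0 ≤ Real.exp 1 * (n * p) := by positivity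
  have hr : Real.exp 1 * (n * p) ≤ 10 / 11 := by nlinarith [Real.exp_pos 1]
  calc (Nat.card (F.Copy H) : ℝ)
    _ ≤ 6 * Real.exp 1 * n * ∑ v ∈ Finset.Ico e (Nat.card V), (Real.exp 1 * (n * p)) ^ v :=
      hs.card_copy_le_geom_sum hp hp1 hnp hF hcard
    _ ≤ 6 * Real.exp 1 * n * ((Real.exp 1 * (n * p)) ^ e / (1 - Real.exp 1 * (n * p))) := by
      gcongr
      exact geom_sum_Ico_le_of_lt_one hr0 (by linarith)
    _ ≤ 6 * Real.exp 1 * n * ((Real.exp 1 * (n * p)) ^ e / (1 / 11)) := by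
      gcongr
      linarith
    _ = 66 * Real.exp 1 * n * (Real.exp 1 * (n * p)) ^ e := by ring
    _ ≤ 180 * n * (3 * (n * p)) ^ e := by gcongr <;> linarith
    _ ≤ 180 ^ e * n * (3 * (n * p)) ^ e := by
      gcongr
      exact le_self_pow₀ (by norm_num) hFe
    _ = (180 * (3 * (n * p))) ^ e * n := by
      rw [mul_pow 180]
      ring
    _ = (540 * p) ^ e * n ^ (e + 1) := by
      rw [show 180 * (3 * (n * p)) = 540 * p * n by ring, mul_pow, pow_succ, mul_assoc]

theorem sum_card_component [Finite W] (F : SimpleGraph W) [Fintype F.ConnectedComponent] :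
    ∑ c : F.ConnectedComponent, Nat.card c = Nat.card W := by
  rw [← Nat.card_sigma]
  exact Nat.card_congr (Equiv.sigmaFiberEquiv F.connectedComponentMk)

theorem sum_ncard_edgeSet_component [Finite W] (F : SimpleGraph W)
    [Fintype F.ConnectedComponent] :
    ∑ c : F.ConnectedComponent, c.toSimpleGraph.edgeSet.ncard = F.edgeSet.ncard := by
  simp only [← Nat.card_coe_set_eq]
  rw [← Nat.card_sigma]
  refine Nat.card_eq_of_bijective (fun x => (componentCopy x.1).mapEdgeSet x.2) ⟨?_, ?_⟩
  · rintro ⟨c, e, he⟩ ⟨c', e', he'⟩ h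
    have h : Sym2.map Subtype.val e = Sym2.map Subtype.val e' := congrArg Subtype.val h
    obtain rfl : c = c' := by
      induction e with | _ a b
      obtain ⟨a', -, ha'⟩ := Sym2.mem_map.1 (h ▸ Sym2.mem_map.2 ⟨a, Sym2.mem_mk_left a b, rfl⟩)
      rw [← show F.connectedComponentMk a = c from a.2,
        ← show F.connectedComponentMk a' = c' from a'.2, ha']
    obtain rfl := Sym2.map.injective Subtype.val_injective h
    rfl
  · rintro ⟨e, he⟩
    induction e with | _ a b
    exact ⟨⟨F.connectedComponentMk a, s(⟨a, rfl⟩,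
      ⟨b, (ConnectedComponent.connectedComponentMk_eq_of_adj he).symm⟩), he⟩, rfl⟩

theorem card_copy_le_prod_component [Finite V] [Finite W] (F : SimpleGraph W)
    [Fintype F.ConnectedComponent] (H : SimpleGraph V) :
    Nat.card (F.Copy H) ≤ ∏ c : F.ConnectedComponent, Nat.card (c.toSimpleGraph.Copy H) := by
  rw [← Nat.card_pi]
  refine Nat.card_le_card_of_injective (fun f c => f.comp (componentCopy c)) fun f f' h => ?_
  ext w
  exact DFunLike.congr_fun (congrFun h (F.connectedComponentMk w)) ⟨w, rfl⟩

theorem IsSparse.card_copy_le_of_forall_exists_adj [Finite V] [Finite W] {n : ℕ} {p : ℝ}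
    {H : SimpleGraph V} (hs : IsSparse n p H) (hp : 0 ≤ p) (hp1 : p ≤ 1) (hnp : n * p ≤ 1 / 3)
    {F : SimpleGraph W} (hF : ∀ w, ∃ w', F.Adj w w') :
    (Nat.card (F.Copy H) : ℝ) ≤ (540 * p) ^ F.edgeSet.ncard * n ^ Nat.card W := by
  classical
  have := Fintype.ofFinite F.ConnectedComponent
  have hedge (c : F.ConnectedComponent) : c.toSimpleGraph.edgeSet.ncard ≠ 0 := by
    obtain ⟨w, hw⟩ := c.connected_toSimpleGraph.nonempty
    obtain ⟨w', hww'⟩ := hF w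
    exact Set.ncard_ne_zero_of_mem (a := s(⟨w, hw⟩, ⟨w', c.mem_supp_of_adj_mem_supp hw hww'⟩)) hww'
  calc (Nat.card (F.Copy H) : ℝ)
    _ ≤ ∏ c : F.ConnectedComponent, (Nat.card (c.toSimpleGraph.Copy H) : ℝ) := by
      exact_mod_cast card_copy_le_prod_component F H
    _ ≤ ∏ c : F.ConnectedComponent,
          ((540 * p) ^ c.toSimpleGraph.edgeSet.ncard * (n : ℝ) ^ Nat.card c) :=
      Finset.prod_le_prod (fun _ _ => by positivity) fun c _ =>
        hs.card_copy_le_of_connected hp hp1 hnp c.connected_toSimpleGraph (hedge c)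
    _ = (540 * p) ^ F.edgeSet.ncard * n ^ Nat.card W := by
      rw [Finset.prod_mul_distrib, Finset.prod_pow_eq_pow_sum, Finset.prod_pow_eq_pow_sum,
        sum_card_component, sum_ncard_edgeSet_component]

theorem IsSparse.card_copy_le_descFactorial_of_mul_le [Finite V] [Finite W] {n : ℕ} {p : ℝ}
    {H : SimpleGraph V} (hs : IsSparse n p H) (hp : 0 ≤ p) (hp1 : p ≤ 1) (hnp : n * p ≤ 1 / 3)
    (hV : Nat.card V ≤ n) (F : SimpleGraph W) :
    (Nat.card (F.Copy H) : ℝ) ≤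
      n.descFactorial (Nat.card W) * (4860 * p) ^ F.edgeSet.ncard := by
  have h := hs.card_copy_le_of_forall_exists_adj hp hp1 hnp (exists_adj_induce_support F)
  rw [← one_mul (n : ℝ)] at h
  convert card_copy_le_descFactorial_mul hV (by positivity) le_rfl h using 3
  ring

theorem fractionalThreshold_lt_mul_of_lt [Fintype V] (n : ℕ) (H : SimpleGraph V)
    (hn : Fintype.card V ≤ n) (hH : H ≠ ⊥) (hp : (graphicThreshold n H : ℝ) < 1 / (3 * (n : ℝ))) :
    (fractionalThreshold n H : ℝ) < 4861 * (graphicThreshold n H : ℝ) := by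
  have hp0 := graphicThreshold_pos hH hn
  have hs := isSparse_of_mem_graphicFeasible (isLeast_graphicThreshold n H hn).1
  have hp1 : (graphicThreshold n H : ℝ) ≤ 1 := (graphicThreshold n H).2.2
  set p : ℝ := (graphicThreshold n H : ℝ)
  rw [← Nat.card_eq_fintype_card] at hn
  have hn0 : (0 : ℝ) < n := by
    have := one_lt_card_of_ne_bot hH
    exact_mod_cast (by omega : 0 < n)
  have hnp : n * p ≤ 1 / 3 := by
    rw [lt_div_iff₀ (by positivity)] at hp
    linarith
  have hle := fractionalThreshold_le_of_card_copy_le (q := 4860 * p) (by positivity) fun J =>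
    hs.card_copy_le_descFactorial_of_mul_le hp0.le hp1 hnp hn J.coe
  linarith

end ExpectationThresholds

theorem theorem1p5 :
    (∃ K : ℝ, ∀ (n : ℕ) (V : Type u) [Fintype V] (H : SimpleGraph V),
      Fintype.card V ≤ n → H ≠ ⊥ →
        (fractionalThreshold n H : ℝ) < K * (graphicThreshold n H : ℝ) * (Real.logb 2 n) ^ 2) ∧
    (∃ α : ℝ, 0 < α ∧ ∀ (n : ℕ) (V : Type u) [Fintype V] (H : SimpleGraph V),
      Fintype.card V ≤ n → H ≠ ⊥ →
        (graphicThreshold n H : ℝ) < 1 / (3 * (n : ℝ)) →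
          (fractionalThreshold n H : ℝ) < α⁻¹ * (graphicThreshold n H : ℝ)) := by
  refine ⟨⟨5308416, fun n V _ H hn hH => fractionalThreshold_lt_mul_log_sq n H hn hH⟩,
    4861⁻¹, by norm_num, fun n V _ H hn hH hp => ?_⟩
  rw [inv_inv]
  exact fractionalThreshold_lt_mul_of_lt n H hn hH hp
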